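/- **Theorem (Adequacy of typing).** If $\Gamma \vdash a : A$ is derivable, then $\Gamma \vDash a : A$. Here the calculus and the two judgments are as follows (names stand for de Bruijn indices, and shifts are implicit). *Syntax.* Constants $c$ are $\mathtt{unit},\mathtt{true},\mathtt{false}$ and integers $z\in\mathbb Z$. Terms are constants, variables, $\lambda x{:}A.b$, $f\,a$, $\Lambda(X:>L<:U).b$, $f[A]$, $\mathsf{let}\ x{:}A=a\ \mathsf{in}\ b$, $(a_1,a_2)$, $\mathsf{match}\ a\ \mathsf{with}\ (x,y)\Rightarrow b$, $\mathsf{match}\ a\ \mathsf{with}\ \mathsf{inl}(x)\Rightarrow b_1\mid\mathsf{inr}(y)\Rightarrow b_2$, $\mathsf{inl}[B]\,a$, $\mathsf{inr}[A]\,a$, $a\ \mathit{op}\ b$, $\mathsf{if}\ a\ \mathsf{then}\ b_1\ \mathsf{else}\ b_2$, $\mathsf{loop}(a)\,x.\,b$, with $\mathit{op}$ among $==,!=,<,<=,>=,>,\&\&,||,+,-,*,/,\%$. Types are $X$, $\mathtt{Unit}$, $\mathtt{True}$, $\mathtt{False}$, $\mathtt{Int32}$, $\top$, $\bot$, $\Pi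 x{:}A.B$, $\forall(X:>L<:U).A$, $\Sigma x{:}A.B$, $A+B$, $\{x:A\mid p\}$ with $p$ any term, $A\lor B$, $A\land B$, $\mu X.A$; $\mathtt{Bool}=\mathtt{True}\lor\mathtt{False}$. Contexts are lists of term bindings $x:A$, type bindings $X:>L<:U$, and equality facts $a_1\sim a_2$, in which each side carries the number of term bindings in scope for it. Values are constants, $(v_1,v_2)$, $\mathsf{inl}(v)$, $\mathsf{inr}(v)$, closures $\langle\rho,\lambda x.b\rangle$ and type closures $\langle\rho,\Lambda X.b\rangle$, where an environment $\rho$ is a list of values. *Evaluation.* The interpreter $\mathsf{eval}\ n\ \rho\ a$ is call-by-value, evaluates from left to right, ignores types, and returns timeout, stuck, or a value. It times out with fuel $0$, and with fuel $n+1$ it runs every subevaluation with fuel $n$ (a loop makes at most $n$ rounds); a subevaluation that times out or gets stuck makes the whole do so, and the elimination of a value of the wrong shape, an unbound variable, and an operation applied outside its domain are stuck. In $\mathsf{loop}(a)\,x.\,b$ the state starts as the value of $a$, and $b$ returns $\mathsf{inl}(v_1)$ to continue with the state $v_1$ or $\mathsf{inr}(v)$ to exit with $v$. Integer operations use signed 32-bit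 wrapping; $/$ truncates towards zero, with $z/0=0$ and $z\,\%\,0=z$; $==$ and $!=$ are defined on two constants of the same kind. Write $\rho\vdash a\Downarrow^? r$ if for some fuel the interpreter returns $r$ (stuck or a value), and $\rho\vdash a\Downarrow v$ if it returns the value $v$. *Semantics.* A semantic type is a predicate on values. For a semantic type $S$, let $\mathrm{Safe}^\rho(S,a)$ say that whenever $\rho\vdash a\Downarrow^? r$, the result $r$ is a value (not stuck) and it is in $S$. For an assignment $\delta$ of semantic types to type variables and an environment $\rho$: $\mathcal V[\![X]\!]=\delta(X)$; $\mathtt{Unit},\mathtt{True},\mathtt{False}$ are the singletons of $\mathtt{unit},\mathtt{true},\mathtt{false}$; $\mathtt{Int32}$ is the set of integer constants; $\top$ and $\bot$ are everything and nothing; $\lor,\land,+$ are union, intersection and tagged union; $\mathcal V[\![\Pi x{:}A.B]\!]_\delta^\rho$ consists of the $\langle\rho_f,\lambda x.b\rangle$ with $\mathrm{Safe}^{\rho_f[x\mapsto w]}(\mathcal V[\![B]\!]_\delta^{\rho[x\mapsto w]},b)$ for all $w\in\mathcal V[\![A]\!]_\delta^\rho$; $\mathcal V[\![\forall(X:>L<:U).B]\!]_\delta^\rho$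 consists of the $\langle\rho_f,\Lambda X.b\rangle$ with $\mathrm{Safe}^{\rho_f}(\mathcal V[\![B]\!]_{\delta[X\mapsto S]}^{\rho},b)$ for all semantic types $S$ with $\mathcal V[\![L]\!]_\delta^\rho\subseteq S\subseteq\mathcal V[\![U]\!]_\delta^\rho$; $\mathcal V[\![\Sigma x{:}A.B]\!]_\delta^\rho$ consists of the $(v_1,v_2)$ with $v_1\in\mathcal V[\![A]\!]_\delta^\rho$ and $v_2\in\mathcal V[\![B]\!]_\delta^{\rho[x\mapsto v_1]}$; $\mathcal V[\![\{x:A\mid p\}]\!]_\delta^\rho$ consists of the $v\in\mathcal V[\![A]\!]_\delta^\rho$ with $\mathrm{Safe}^{\rho[x\mapsto v]}(\{\mathtt{true}\},p)$; $\mathcal V[\![\mu X.A]\!]_\delta^\rho=\bigcap_n F^n$, where $F^0$ is everything and $F^{n+1}=\mathcal V[\![A]\!]_{\delta[X\mapsto F^n]}^\rho$. The pair $(\delta,\rho)$ is consistent with $\Gamma$, written $\mathrm{wf}(\delta,\Gamma,\rho)$, if $\rho(x)$ is defined and in $\mathcal V[\![A]\!]_\delta^\rho$ for each $x:A$ in $\Gamma$,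 if $\mathcal V[\![L]\!]_\delta^\rho\subseteq\delta(X)\subseteq\mathcal V[\![U]\!]_\delta^\rho$ for each $X:>L<:U$ in $\Gamma$, and if for each fact $a_1\sim a_2$ in $\Gamma$ there is a value $v$ to which both sides evaluate, each side in the part of $\rho$ that holds the bindings in scope for it. Semantic typing $\Gamma\vDash a:A$ says that $\mathrm{Safe}^\rho(\mathcal V[\![A]\!]_\delta^\rho,a)$ for all $\delta,\rho$ with $\mathrm{wf}(\delta,\Gamma,\rho)$. Semantic implication $\Gamma\vDash p_1\Rightarrow p_2$ says that $\mathrm{Safe}^\rho(\{\mathtt{true}\},p_1)$ implies $\mathrm{Safe}^\rho(\{\mathtt{true}\},p_2)$ for all $\delta,\rho$ with $\mathrm{wf}(\delta,\Gamma,\rho)$. *Auxiliary notions.* Strict positivity $\mathsf{spos}(X,A)$ holds for variables, base types, $\top$ and $\bot$; for $\Sigma y{:}A.B$, $A+B$ and $A\land B$ if it holds for $A$ and $B$; for $\{y:A\mid p\}$ if it holds for $A$; for $\Pi y{:}A.B$ if $X\notin A$ and $\mathsf{spos}(X,B)$; for $\forall(Y:>L<:U).B$ if $X\notin L$, $X\notin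 U$ and $\mathsf{spos}(X,B)$; for $A\lor B$ if $X\notin A$ and $X\notin B$; for $\mu Y.A$ if $\mathsf{spos}(Y,A)$ and $X\notin A$. Here $X\notin A$ means that $X$ does not occur free in $A$. Avoidance $\mathsf{avoid}(A,x)$ traverses $A$ with a polarity, initially positive, that flips in the domain of $\Pi$ and in the upper bound of $\forall$; it replaces each refinement predicate that mentions $x$ by $\mathtt{true}$ (positive) or $\mathtt{false}$ (negative), and replaces each $\mu Y.B$ without $\mathsf{spos}(Y,B)$ by $\top$ (positive) or $\bot$ (negative). The predicate $\mathsf{firstorder}(A)$ holds for $\mathtt{Unit},\mathtt{True},\mathtt{False},\mathtt{Int32}$ and iterated refinements of these. The predicate $\mathsf{compat}(\mathit{op},A)$ requires $\mathsf{firstorder}(A)$ or $A=\mathtt{Bool}$ for $==,!=$; $A=\mathtt{Bool}$ for $\&\&,||$; $A=\mathtt{Int32}$ otherwise. The type $\mathsf{result}(\mathit{op},A)$ is $\mathtt{Int32}$ for $+,-,*,/,\%$ and $\mathtt{Bool}$ otherwise. *Subtyping* $\Gamma\vdash A<:B$ is inductively generated by reflexivity; transitivity; $A<:\top$; $\bot<:A$;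 the lattice rules for $\lor$ and $\land$; $\{x:A\mid p\}<:A$; and the following rules. If $\Gamma\vdash B_1<:A_1$ and $\Gamma,x:A_1\vdash A_2<:B_2$, then $\Gamma\vdash\Pi x{:}A_1.A_2<:\Pi x{:}B_1.B_2$. If $\Gamma\vdash A_1<:B_1$ and $\Gamma,x:A_1\vdash A_2<:B_2$, then $\Gamma\vdash\Sigma x{:}A_1.A_2<:\Sigma x{:}B_1.B_2$. If $\Gamma\vdash A<:B$ and $\Gamma,x:A\vDash p_1\Rightarrow p_2$, then $\Gamma\vdash\{x:A\mid p_1\}<:\{x:B\mid p_2\}$. If $X:>L<:U\in\Gamma$, then $\Gamma\vdash L<:X$ and $\Gamma\vdash X<:U$. If $\mathsf{spos}(X,A)$, then $\Gamma\vdash\mu X.A<:A[X\mapsto\mu X.A]$ and $\Gamma\vdash A[X\mapsto\mu X.A]<:\mu X.A$. If $\Gamma\vdash L_1<:L_2$, $\Gamma\vdash U_2<:U_1$ and $\Gamma,X:>L_2<:U_2\vdash A<:B$, then $\Gamma\vdash\forall(X:>L_1<:U_1).A<:\forall(X:>L_2<:U_2).B$. *Typing* $\Gamma\vdash a:A$ is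 inductively generated by $\mathtt{unit}:\mathtt{Unit}$, $\mathtt{true}:\mathtt{True}$, $\mathtt{false}:\mathtt{False}$, $z:\mathtt{Int32}$, $x:A$ for $x:A\in\Gamma$, and the following rules. If $\Gamma,x:A\vdash b:B$, then $\Gamma\vdash\lambda x{:}A.b:\Pi x{:}A.B$. If $\Gamma\vdash f:\Pi x{:}A.B$ and $\Gamma\vdash y:A$ for a variable $y$, then $\Gamma\vdash f\,y:B[x\mapsto y]$. If $\Gamma,X:>L<:U\vdash b:B$, then $\Gamma\vdash\Lambda(X:>L<:U).b:\forall(X:>L<:U).B$. If $\Gamma\vdash f:\forall(X:>L<:U).B$, $\Gamma\vdash L<:A$ and $\Gamma\vdash A<:U$, then $\Gamma\vdash f[A]:B[X\mapsto A]$. If $\Gamma\vdash a:A$ and $\Gamma,x:A,x\sim a\vdash b:B$, then $\Gamma\vdash\mathsf{let}\ x{:}A=a\ \mathsf{in}\ b:\mathsf{avoid}(B,x)$. If $\Gamma\vdash y:A$ for a variable $y$ and $\Gamma\vdash a_2:B[x\mapsto y]$, then $\Gamma\vdash(y,a_2):\Sigma x{:}A.B$. If $\Gamma\vdash a:A$,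 $\Gamma\vdash b:A$ and $\mathsf{compat}(\mathit{op},A)$, then $\Gamma\vdash a\ \mathit{op}\ b:\mathsf{result}(\mathit{op},A)$. If $\Gamma\vdash a:\mathtt{Bool}$, $\Gamma,a\sim\mathtt{true}\vdash b_1:B_1$ and $\Gamma,a\sim\mathtt{false}\vdash b_2:B_2$, then $\Gamma\vdash\mathsf{if}\ a\ \mathsf{then}\ b_1\ \mathsf{else}\ b_2:B_1\lor B_2$. If $\Gamma\vdash a:A$, then $\Gamma\vdash\mathsf{inl}[B]\,a:A+B$; if $\Gamma\vdash a:B$, then $\Gamma\vdash\mathsf{inr}[A]\,a:A+B$. If $\Gamma\vdash a:A$ and $\Gamma,x:A\vdash b:A+B$ (with $x$ not in $A+B$), then $\Gamma\vdash\mathsf{loop}(a)\,x.\,b:B$. If $\Gamma\vdash a:A$ and $\mathsf{firstorder}(A)$, then $\Gamma\vdash a:\{x:A\mid x==a\}$. If $\Gamma\vdash a:A$ and $\Gamma\vdash A<:B$, then $\Gamma\vdash a:B$. If $\Gamma\vdash a:\Sigma x{:}A.B$ and $\Gamma,x:A,y:B\vdash b:C$, then $\Gamma\vdash\mathsf{match}\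 a\ \mathsf{with}\ (x,y)\Rightarrow b:\mathsf{avoid}(\mathsf{avoid}(C,y),x)$. If $\Gamma\vdash a:A_1+A_2$, $\Gamma,x:A_1,a\sim\mathsf{inl}(x)\vdash b_1:B_1$ and $\Gamma,y:A_2,a\sim\mathsf{inr}(y)\vdash b_2:B_2$, then $\Gamma\vdash\mathsf{match}\ a\ \mathsf{with}\ \mathsf{inl}(x)\Rightarrow b_1\mid\mathsf{inr}(y)\Rightarrow b_2:\mathsf{avoid}(B_1,x)\lor\mathsf{avoid}(B_2,y)$. In these rules, in a fact that mentions $a$, the side $a$ has the bindings of $\Gamma$ in scope, while a side that mentions the new variable, $x$ or $y$, has that one in scope as well. -/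

import Mathlib

namespace RefCore

/-! ## Syntax (de Bruijn indices; term and type variables are two separate index spaces) -/

/-- Constants. -/
inductive Const : Type where
  | unit : Const
  | bool : Bool → Const
  | int : ℤ → Const

/-- Binary operations. -/
inductive Op : Type where
  | eq | ne | lt | le | ge | gt | and | or | plus | minus | times | quot | rem

mutual

/-- Types. `pi`, `sigma` and `refine` bind one term variable in their last argument; `all L U B`
and `mu` bind one type variable in their last argument. -/
inductive Ty : Type where
  | var : ℕ → Ty
  | unit : Ty
  | tru : Ty
  | fls : Ty
  | int32 : Ty
  | top : Ty
  | bot : Ty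
  | pi : Ty → Ty → Ty
  | all : Ty → Ty → Ty → Ty
  | sigma : Ty → Ty → Ty
  | sum : Ty → Ty → Ty
  | refine : Ty → Term → Ty
  | union : Ty → Ty → Ty
  | inter : Ty → Ty → Ty
  | mu : Ty → Ty

/-- Terms. `abs A b`, `letin A a b` and `loop a b` bind one term variable in `b`; `tabs L U b`
binds one type variable in `b`; `matchPair a b` binds the first component as index `1` and the
second as index `0` in `b`; `matchSum a bl br` binds one term variable in each branch. -/
inductive Term : Type where
  | const : Const → Term
  | var : ℕ → Term
  | abs : Ty → Term → Term
  | app : Term → Term → Term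
  | tabs : Ty → Ty → Term → Term
  | tapp : Term → Ty → Term
  | letin : Ty → Term → Term → Term
  | pair : Term → Term → Term
  | matchPair : Term → Term → Term
  | matchSum : Term → Term → Term → Term
  | inl : Ty → Term → Term
  | inr : Ty → Term → Term
  | binop : Op → Term → Term → Term
  | ite : Term → Term → Term → Term
  | loop : Term → Term → Term

end

/-- The type of booleans, `True ∨ False`. -/
def Ty.bool : Ty := .union .tru .fls

/-- The boolean constants, as terms. -/
def Term.tt : Term := .const (.bool true)
def Term.ff : Term := .const (.bool false)

/-! ## Renaming, shifting and substitution -/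

/-- Lift a renaming under one binder. -/
def liftRen (ξ : ℕ → ℕ) : ℕ → ℕ
  | 0 => 0
  | n + 1 => ξ n + 1

mutual

/-- Rename the free type variables by `τ` and the free term variables by `ξ`. -/
def Ty.ren (τ ξ : ℕ → ℕ) : Ty → Ty
  | .var X => .var (τ X)
  | .unit => .unit
  | .tru => .tru
  | .fls => .fls
  | .int32 => .int32
  | .top => .top
  | .bot => .bot
  | .pi A B => .pi (A.ren τ ξ) (B.ren τ (liftRen ξ))
  | .all L U B => .all (L.ren τ ξ) (U.ren τ ξ) (B.ren (liftRen τ) ξ)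
  | .sigma A B => .sigma (A.ren τ ξ) (B.ren τ (liftRen ξ))
  | .sum A B => .sum (A.ren τ ξ) (B.ren τ ξ)
  | .refine A p => .refine (A.ren τ ξ) (p.ren τ (liftRen ξ))
  | .union A B => .union (A.ren τ ξ) (B.ren τ ξ)
  | .inter A B => .inter (A.ren τ ξ) (B.ren τ ξ)
  | .mu A => .mu (A.ren (liftRen τ) ξ)

/-- Rename the free type variables by `τ` and the free term variables by `ξ`. -/
def Term.ren (τ ξ : ℕ → ℕ) : Term → Term
  | .const c => .const c
  | .var x => .var (ξ x)
  | .abs A b => .abs (A.ren τ ξ) (b.ren τ (liftRen ξ))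
  | .app f a => .app (f.ren τ ξ) (a.ren τ ξ)
  | .tabs L U b => .tabs (L.ren τ ξ) (U.ren τ ξ) (b.ren (liftRen τ) ξ)
  | .tapp f A => .tapp (f.ren τ ξ) (A.ren τ ξ)
  | .letin A a b => .letin (A.ren τ ξ) (a.ren τ ξ) (b.ren τ (liftRen ξ))
  | .pair a b => .pair (a.ren τ ξ) (b.ren τ ξ)
  | .matchPair a b => .matchPair (a.ren τ ξ) (b.ren τ (liftRen (liftRen ξ)))
  | .matchSum a b c => .matchSum (a.ren τ ξ) (b.ren τ (liftRen ξ)) (c.ren τ (liftRen ξ))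
  | .inl A a => .inl (A.ren τ ξ) (a.ren τ ξ)
  | .inr A a => .inr (A.ren τ ξ) (a.ren τ ξ)
  | .binop op a b => .binop op (a.ren τ ξ) (b.ren τ ξ)
  | .ite a b c => .ite (a.ren τ ξ) (b.ren τ ξ) (c.ren τ ξ)
  | .loop a b => .loop (a.ren τ ξ) (b.ren τ (liftRen ξ))

end

/-- Shift all free term variables by one. -/
def Ty.shiftTm (A : Ty) : Ty := A.ren id Nat.succ
/-- Shift all free type variables by one. -/
def Ty.shiftTy (A : Ty) : Ty := A.ren Nat.succ id
/-- Shift all free term variables by one. -/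
def Term.shiftTm (a : Term) : Term := a.ren id Nat.succ

/-- `B[x ↦ y]`: the most recent term variable is replaced by the variable `y`. -/
def Ty.instTm (B : Ty) (y : ℕ) : Ty :=
  B.ren id (fun x => match x with
    | 0 => y
    | x + 1 => x)

/-- Remove the most recent term variable from the scope of a type that does not mention it. -/
def Ty.lowerTm (B : Ty) : Ty := B.ren id Nat.pred

/-- Lift a type substitution under a term binder. -/
def liftSubTm (σ : ℕ → Ty) : ℕ → Ty := fun X => (σ X).shiftTm

/-- Lift a type substitution under a type binder. -/
def liftSubTy (σ : ℕ → Ty) : ℕ → Ty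
  | 0 => .var 0
  | X + 1 => (σ X).shiftTy

mutual

/-- Capture-avoiding simultaneous substitution of types for the free type variables. -/
def Ty.sub (σ : ℕ → Ty) : Ty → Ty
  | .var X => σ X
  | .unit => .unit
  | .tru => .tru
  | .fls => .fls
  | .int32 => .int32
  | .top => .top
  | .bot => .bot
  | .pi A B => .pi (A.sub σ) (B.sub (liftSubTm σ))
  | .all L U B => .all (L.sub σ) (U.sub σ) (B.sub (liftSubTy σ))
  | .sigma A B => .sigma (A.sub σ) (B.sub (liftSubTm σ))
  | .sum A B => .sum (A.sub σ) (B.sub σ)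
  | .refine A p => .refine (A.sub σ) (p.sub (liftSubTm σ))
  | .union A B => .union (A.sub σ) (B.sub σ)
  | .inter A B => .inter (A.sub σ) (B.sub σ)
  | .mu A => .mu (A.sub (liftSubTy σ))

/-- Capture-avoiding simultaneous substitution of types for the free type variables. -/
def Term.sub (σ : ℕ → Ty) : Term → Term
  | .const c => .const c
  | .var x => .var x
  | .abs A b => .abs (A.sub σ) (b.sub (liftSubTm σ))
  | .app f a => .app (f.sub σ) (a.sub σ)
  | .tabs L U b => .tabs (L.sub σ) (U.sub σ) (b.sub (liftSubTy σ))
  | .tapp f A => .tapp (f.sub σ) (A.sub σ)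
  | .letin A a b => .letin (A.sub σ) (a.sub σ) (b.sub (liftSubTm σ))
  | .pair a b => .pair (a.sub σ) (b.sub σ)
  | .matchPair a b => .matchPair (a.sub σ) (b.sub (liftSubTm (liftSubTm σ)))
  | .matchSum a b c => .matchSum (a.sub σ) (b.sub (liftSubTm σ)) (c.sub (liftSubTm σ))
  | .inl A a => .inl (A.sub σ) (a.sub σ)
  | .inr A a => .inr (A.sub σ) (a.sub σ)
  | .binop op a b => .binop op (a.sub σ) (b.sub σ)
  | .ite a b c => .ite (a.sub σ) (b.sub σ) (c.sub σ)
  | .loop a b => .loop (a.sub σ) (b.sub (liftSubTm σ))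

end

/-- `B[X ↦ A]`: the most recent type variable is replaced by the type `A`. -/
def Ty.instTy (B A : Ty) : Ty :=
  B.sub (fun X => match X with
    | 0 => A
    | X + 1 => .var X)

/-! ## Free occurrences, strict positivity, avoidance -/

mutual

/-- The type variable `X` occurs free. -/
def Ty.hasTy (X : ℕ) : Ty → Bool
  | .var Y => X == Y
  | .unit | .tru | .fls | .int32 | .top | .bot => false
  | .pi A B => A.hasTy X || B.hasTy X
  | .all L U B => L.hasTy X || U.hasTy X || B.hasTy (X + 1)
  | .sigma A B => A.hasTy X || B.hasTy X
  | .sum A B => A.hasTy X || B.hasTy X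
  | .refine A p => A.hasTy X || p.hasTy X
  | .union A B => A.hasTy X || B.hasTy X
  | .inter A B => A.hasTy X || B.hasTy X
  | .mu A => A.hasTy (X + 1)

/-- The type variable `X` occurs free. -/
def Term.hasTy (X : ℕ) : Term → Bool
  | .const _ => false
  | .var _ => false
  | .abs A b => A.hasTy X || b.hasTy X
  | .app f a => f.hasTy X || a.hasTy X
  | .tabs L U b => L.hasTy X || U.hasTy X || b.hasTy (X + 1)
  | .tapp f A => f.hasTy X || A.hasTy X
  | .letin A a b => A.hasTy X || a.hasTy X || b.hasTy X
  | .pair a b => a.hasTy X || b.hasTy X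
  | .matchPair a b => a.hasTy X || b.hasTy X
  | .matchSum a b c => a.hasTy X || b.hasTy X || c.hasTy X
  | .inl A a => A.hasTy X || a.hasTy X
  | .inr A a => A.hasTy X || a.hasTy X
  | .binop _ a b => a.hasTy X || b.hasTy X
  | .ite a b c => a.hasTy X || b.hasTy X || c.hasTy X
  | .loop a b => a.hasTy X || b.hasTy X

end

mutual

/-- The term variable `x` occurs free. -/
def Ty.hasTm (x : ℕ) : Ty → Bool
  | .var _ | .unit | .tru | .fls | .int32 | .top | .bot => false
  | .pi A B => A.hasTm x || B.hasTm (x + 1)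
  | .all L U B => L.hasTm x || U.hasTm x || B.hasTm x
  | .sigma A B => A.hasTm x || B.hasTm (x + 1)
  | .sum A B => A.hasTm x || B.hasTm x
  | .refine A p => A.hasTm x || p.hasTm (x + 1)
  | .union A B => A.hasTm x || B.hasTm x
  | .inter A B => A.hasTm x || B.hasTm x
  | .mu A => A.hasTm x

/-- The term variable `x` occurs free. -/
def Term.hasTm (x : ℕ) : Term → Bool
  | .const _ => false
  | .var y => x == y
  | .abs A b => A.hasTm x || b.hasTm (x + 1)
  | .app f a => f.hasTm x || a.hasTm x
  | .tabs L U b => L.hasTm x || U.hasTm x || b.hasTm x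
  | .tapp f A => f.hasTm x || A.hasTm x
  | .letin A a b => A.hasTm x || a.hasTm x || b.hasTm (x + 1)
  | .pair a b => a.hasTm x || b.hasTm x
  | .matchPair a b => a.hasTm x || b.hasTm (x + 2)
  | .matchSum a b c => a.hasTm x || b.hasTm (x + 1) || c.hasTm (x + 1)
  | .inl A a => A.hasTm x || a.hasTm x
  | .inr A a => A.hasTm x || a.hasTm x
  | .binop _ a b => a.hasTm x || b.hasTm x
  | .ite a b c => a.hasTm x || b.hasTm x || c.hasTm x
  | .loop a b => a.hasTm x || b.hasTm (x + 1)

end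

/-- Strict positivity of the type variable `X`. -/
def Ty.spos (X : ℕ) : Ty → Bool
  | .var _ | .unit | .tru | .fls | .int32 | .top | .bot => true
  | .pi A B => !A.hasTy X && B.spos X
  | .all L U B => !L.hasTy X && !U.hasTy X && B.spos (X + 1)
  | .mu A => A.spos 0 && !A.hasTy (X + 1)
  | .sigma A B => A.spos X && B.spos X
  | .sum A B => A.spos X && B.spos X
  | .refine A _ => A.spos X
  | .union A B => !A.hasTy X && !B.hasTy X
  | .inter A B => A.spos X && B.spos X

/-- Avoidance of the term variable `i`, with polarity `pol` (`true` is positive and yields a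
supertype, `false` is negative and yields a subtype). The result is in the same scope, but does
not mention `i`. -/
def Ty.avoid (i : ℕ) (pol : Bool) : Ty → Ty
  | .var X => .var X
  | .unit => .unit
  | .tru => .tru
  | .fls => .fls
  | .int32 => .int32
  | .top => .top
  | .bot => .bot
  | .pi A B => .pi (A.avoid i (!pol)) (B.avoid (i + 1) pol)
  | .all L U B => .all (L.avoid i pol) (U.avoid i (!pol)) (B.avoid i pol)
  | .sigma A B => .sigma (A.avoid i pol) (B.avoid (i + 1) pol)
  | .sum A B => .sum (A.avoid i pol) (B.avoid i pol)
  | .refine A p =>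
      .refine (A.avoid i pol) (if p.hasTm (i + 1) then .const (.bool pol) else p)
  | .union A B => .union (A.avoid i pol) (B.avoid i pol)
  | .inter A B => .inter (A.avoid i pol) (B.avoid i pol)
  | .mu A => if A.spos 0 then .mu (A.avoid i pol) else if pol then .top else .bot

/-- `avoid(B, x)` for the most recent term variable `x`, as a type in the scope without `x`. -/
def Ty.avoidTop (B : Ty) : Ty := (B.avoid 0 true).lowerTm

/-! ## Values and the fuel-bounded definitional interpreter -/

/-- Values. Closures capture their environment, most recent binding first. -/
inductive Value : Type where
  | const : Const → Value
  | pair : Value → Value → Value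
  | inl : Value → Value
  | inr : Value → Value
  | clos : List Value → Term → Value
  | tclos : List Value → Term → Value

/-- Environments, most recent binding first. -/
abbrev Env : Type := List Value

/-- Interpreter results: `none` is timeout, `some none` is stuck, `some (some v)` is success. -/
abbrev Res : Type := Option (Option Value)

/-- Continue on success, propagate timeout and stuck. -/
def Res.andThen (r : Res) (k : Value → Res) : Res :=
  match r with
  | none => none
  | some none => some none
  | some (some v) => k v

/-- The signed 32-bit integer represented by `z`. -/
def wrap (z : ℤ) : ℤ := Int.bmod z (2 ^ 32)

/-- Binary operations on constants; `none` where the operation is not defined. Integers are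
signed 32-bit with wrapping. Division truncates towards zero and is total, with
`z / 0 = 0` and `z % 0 = z`. -/
def Op.evalConst : Op → Const → Const → Option Const
  | .eq, .unit, .unit => some (.bool true)
  | .ne, .unit, .unit => some (.bool false)
  | .eq, .bool a, .bool b => some (.bool (a == b))
  | .ne, .bool a, .bool b => some (.bool (a != b))
  | .and, .bool a, .bool b => some (.bool (a && b))
  | .or, .bool a, .bool b => some (.bool (a || b))
  | .eq, .int a, .int b => some (.bool (wrap a == wrap b))
  | .ne, .int a, .int b => some (.bool (wrap a != wrap b))
  | .lt, .int a, .int b => some (.bool (decide (wrap a < wrap b)))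
  | .le, .int a, .int b => some (.bool (decide (wrap a ≤ wrap b)))
  | .ge, .int a, .int b => some (.bool (decide (wrap a ≥ wrap b)))
  | .gt, .int a, .int b => some (.bool (decide (wrap a > wrap b)))
  | .plus, .int a, .int b => some (.int (wrap (a + b)))
  | .minus, .int a, .int b => some (.int (wrap (a - b)))
  | .times, .int a, .int b => some (.int (wrap (a * b)))
  | .quot, .int a, .int b => some (.int (wrap ((wrap a).tdiv (wrap b))))
  | .rem, .int a, .int b => some (.int (wrap ((wrap a).tmod (wrap b))))
  | _, _, _ => none

/-- The partial function `δ(op, v₁, v₂)` on values. -/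
def Op.delta (op : Op) : Value → Value → Option Value
  | .const c, .const d => (op.evalConst c d).map Value.const
  | _, _ => none

/-- At most `k` rounds of a loop whose body is `step`: `inl` continues with a new state, `inr`
exits with the result, any other value is stuck. -/
def loopIter (step : Value → Res) : ℕ → Value → Res
  | 0, _ => none
  | k + 1, v => (step v).andThen fun w =>
      match w with
      | .inl v' => loopIter step k v'
      | .inr v' => some (some v')
      | _ => some none

/-- The definitional interpreter. The fuel bounds the depth of evaluation. -/
def eval : ℕ → Env → Term → Res
  | 0, _, _ => none
  | n + 1, ρ, t =>
    match t with
    | .const c => some (some (.const c))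
    | .var x => some ρ[x]?
    | .abs _ b => some (some (.clos ρ b))
    | .app f a => (eval n ρ f).andThen fun vf =>
        match vf with
        | .clos ρf b => (eval n ρ a).andThen fun va => eval n (va :: ρf) b
        | _ => some none
    | .tabs _ _ b => some (some (.tclos ρ b))
    | .tapp f _ => (eval n ρ f).andThen fun vf =>
        match vf with
        | .tclos ρf b => eval n ρf b
        | _ => some none
    | .letin _ a b => (eval n ρ a).andThen fun va => eval n (va :: ρ) b
    | .pair a b => (eval n ρ a).andThen fun va => (eval n ρ b).andThen fun vb =>
        some (some (.pair va vb))
    | .matchPair a b => (eval n ρ a).andThen fun va =>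
        match va with
        | .pair v₁ v₂ => eval n (v₂ :: v₁ :: ρ) b
        | _ => some none
    | .matchSum a bl br => (eval n ρ a).andThen fun va =>
        match va with
        | .inl v => eval n (v :: ρ) bl
        | .inr v => eval n (v :: ρ) br
        | _ => some none
    | .inl _ a => (eval n ρ a).andThen fun va => some (some (.inl va))
    | .inr _ a => (eval n ρ a).andThen fun va => some (some (.inr va))
    | .binop op a b => (eval n ρ a).andThen fun va => (eval n ρ b).andThen fun vb =>
        some (op.delta va vb)
    | .ite a b c => (eval n ρ a).andThen fun va =>
        match va with
        | .const (.bool true) => eval n ρ b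
        | .const (.bool false) => eval n ρ c
        | _ => some none
    | .loop a b => (eval n ρ a).andThen fun va => loopIter (fun v => eval n (v :: ρ) b) n va

/-- Evaluation terminates with result `r` (stuck if `r = none`). -/
def Terminates (ρ : Env) (a : Term) (r : Option Value) : Prop :=
  ∃ n, eval n ρ a = some r

/-- Successful evaluation. -/
def EvalsTo (ρ : Env) (a : Term) (v : Value) : Prop :=
  Terminates ρ a (some v)

/-! ## Interpretation of types -/

/-- Semantic types. -/
abbrev SemTy : Type := Value → Prop

/-- Type variable assignments. -/
abbrev TyEnv : Type := ℕ → SemTy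

/-- `δ[X ↦ S]` for a new type variable `X`. -/
def TyEnv.cons (S : SemTy) (δ : TyEnv) : TyEnv
  | 0 => S
  | X + 1 => δ X

/-- Semantic type inclusion. -/
def SemTy.Incl (S T : SemTy) : Prop := ∀ v, S v → T v

/-- Partial correctness: if `a` terminates in `ρ`, the result is a value in `S`. -/
def Safe (S : SemTy) (ρ : Env) (a : Term) : Prop :=
  ∀ r, Terminates ρ a r → ∃ v, r = some v ∧ S v

/-- The semantic type `{true}`. -/
def semTrue : SemTy := fun v => v = .const (.bool true)

/-- Finite approximations of the recursive type of `F`: `F⁰ = ⊤` and `Fⁿ⁺¹ = F (Fⁿ)`. -/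
def approx (F : SemTy → SemTy) : ℕ → SemTy
  | 0 => fun _ => True
  | n + 1 => F (approx F n)

/-- The value interpretation. For `pi` and `all`, the result type is interpreted in the
environment `ρ` of the type, while the body is run in the environment of the closure. -/
def Ty.V : Ty → TyEnv → Env → SemTy
  | .var X, δ, _ => δ X
  | .unit, _, _ => fun v => v = .const .unit
  | .tru, _, _ => semTrue
  | .fls, _, _ => fun v => v = .const (.bool false)
  | .int32, _, _ => fun v => ∃ z : ℤ, v = .const (.int z)
  | .top, _, _ => fun _ => True
  | .bot, _, _ => fun _ => False
  | .pi A B, δ, ρ => fun v => ∃ ρf b, v = .clos ρf b ∧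
      ∀ va, A.V δ ρ va → Safe (B.V δ (va :: ρ)) (va :: ρf) b
  | .all L U B, δ, ρ => fun v => ∃ ρf b, v = .tclos ρf b ∧
      ∀ S : SemTy, (L.V δ ρ).Incl S → S.Incl (U.V δ ρ) → Safe (B.V (δ.cons S) ρ) ρf b
  | .sigma A B, δ, ρ => fun v => ∃ v₁ v₂, v = .pair v₁ v₂ ∧ A.V δ ρ v₁ ∧ B.V δ (v₁ :: ρ) v₂
  | .sum A B, δ, ρ => fun v =>
      (∃ w, v = .inl w ∧ A.V δ ρ w) ∨ (∃ w, v = .inr w ∧ B.V δ ρ w)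
  | .refine A p, δ, ρ => fun v => A.V δ ρ v ∧ Safe semTrue (v :: ρ) p
  | .union A B, δ, ρ => fun v => A.V δ ρ v ∨ B.V δ ρ v
  | .inter A B, δ, ρ => fun v => A.V δ ρ v ∧ B.V δ ρ v
  | .mu A, δ, ρ => fun v => ∀ n, approx (fun S => A.V (δ.cons S) ρ) n v

/-- The term interpretation. -/
def Ty.E (A : Ty) (δ : TyEnv) (ρ : Env) (a : Term) : Prop := Safe (A.V δ ρ) ρ a

/-! ## Contexts -/

/-- Context entries: a term binding, a type variable with its bounds, or an equality fact. Each
side of a fact carries the number of term bindings that are in scope for it. -/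
inductive Entry : Type where
  | tm : Ty → Entry
  | ty : Ty → Ty → Entry
  | fact : ℕ → Term → ℕ → Term → Entry

/-- Contexts, most recent entry first. -/
abbrev Ctx : Type := List Entry

/-- The number of term bindings. -/
def Ctx.depth : Ctx → ℕ
  | [] => 0
  | .tm _ :: Γ => Ctx.depth Γ + 1
  | .ty _ _ :: Γ => Ctx.depth Γ
  | .fact _ _ _ _ :: Γ => Ctx.depth Γ

/-- The type of a term variable, in the scope of the whole context. -/
def Ctx.lookupTm : Ctx → ℕ → Option Ty
  | [], _ => none
  | .tm A :: _, 0 => some A.shiftTm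
  | .tm _ :: Γ, x + 1 => (Ctx.lookupTm Γ x).map Ty.shiftTm
  | .ty _ _ :: Γ, x => (Ctx.lookupTm Γ x).map Ty.shiftTy
  | .fact _ _ _ _ :: Γ, x => Ctx.lookupTm Γ x

/-- The bounds of a type variable, in the scope of the whole context. -/
def Ctx.lookupTy : Ctx → ℕ → Option (Ty × Ty)
  | [], _ => none
  | .tm _ :: Γ, X => (Ctx.lookupTy Γ X).map (Prod.map Ty.shiftTm Ty.shiftTm)
  | .ty L U :: _, 0 => some (L.shiftTy, U.shiftTy)
  | .ty _ _ :: Γ, X + 1 => (Ctx.lookupTy Γ X).map (Prod.map Ty.shiftTy Ty.shiftTy)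
  | .fact _ _ _ _ :: Γ, X => Ctx.lookupTy Γ X

/-- Every equality fact holds: both sides evaluate to a common value, each in the suffix of the
environment that holds the bindings in scope for it. -/
def Ctx.FactsHold : Ctx → Env → Prop
  | [], _ => True
  | .tm _ :: Γ, ρ => Ctx.FactsHold Γ ρ.tail
  | .ty _ _ :: Γ, ρ => Ctx.FactsHold Γ ρ
  | .fact d₁ a₁ d₂ a₂ :: Γ, ρ =>
      (∃ v, EvalsTo (ρ.drop (Ctx.depth Γ - d₁)) a₁ v ∧
        EvalsTo (ρ.drop (Ctx.depth Γ - d₂)) a₂ v) ∧ Ctx.FactsHold Γ ρ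

/-- The assignments `δ` and `ρ` are consistent with `Γ`. -/
structure Wf (δ : TyEnv) (Γ : Ctx) (ρ : Env) : Prop where
  tm : ∀ x A, Ctx.lookupTm Γ x = some A → ∃ v, ρ[x]? = some v ∧ A.V δ ρ v
  ty : ∀ X L U, Ctx.lookupTy Γ X = some (L, U) →
    (L.V δ ρ).Incl (δ X) ∧ (δ X).Incl (U.V δ ρ)
  facts : Ctx.FactsHold Γ ρ

/-! ## Semantic judgments -/

/-- Semantic typing `Γ ⊨ a : A`. -/
def SemTyping (Γ : Ctx) (a : Term) (A : Ty) : Prop :=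
  ∀ (δ : TyEnv) (ρ : Env), Wf δ Γ ρ → A.E δ ρ a

/-- Semantic implication `Γ ⊨ p₁ ⇒ p₂`. -/
def SemImp (Γ : Ctx) (p₁ p₂ : Term) : Prop :=
  ∀ (δ : TyEnv) (ρ : Env), Wf δ Γ ρ → Ty.tru.E δ ρ p₁ → Ty.tru.E δ ρ p₂

/-! ## Syntactic judgments -/

/-- Syntactic subtyping `Γ ⊢ A <: B`. -/
inductive Subtyping : Ctx → Ty → Ty → Prop where
  | refl (Γ : Ctx) (A : Ty) : Subtyping Γ A A
  | trans {Γ : Ctx} {A B C : Ty} : Subtyping Γ A B → Subtyping Γ B C → Subtyping Γ A C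
  | top (Γ : Ctx) (A : Ty) : Subtyping Γ A .top
  | bot (Γ : Ctx) (A : Ty) : Subtyping Γ .bot A
  | pi {Γ : Ctx} {A₁ A₂ B₁ B₂ : Ty} :
      Subtyping Γ B₁ A₁ → Subtyping (.tm A₁ :: Γ) A₂ B₂ →
      Subtyping Γ (.pi A₁ A₂) (.pi B₁ B₂)
  | sigma {Γ : Ctx} {A₁ A₂ B₁ B₂ : Ty} :
      Subtyping Γ A₁ B₁ → Subtyping (.tm A₁ :: Γ) A₂ B₂ →
      Subtyping Γ (.sigma A₁ A₂) (.sigma B₁ B₂)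
  | orL (Γ : Ctx) (A B : Ty) : Subtyping Γ A (.union A B)
  | orR (Γ : Ctx) (A B : Ty) : Subtyping Γ B (.union A B)
  | or {Γ : Ctx} {A B C : Ty} :
      Subtyping Γ A C → Subtyping Γ B C → Subtyping Γ (.union A B) C
  | andL (Γ : Ctx) (A B : Ty) : Subtyping Γ (.inter A B) A
  | andR (Γ : Ctx) (A B : Ty) : Subtyping Γ (.inter A B) B
  | and {Γ : Ctx} {A B C : Ty} :
      Subtyping Γ C A → Subtyping Γ C B → Subtyping Γ C (.inter A B)
  | refineBase (Γ : Ctx) (A : Ty) (p : Term) : Subtyping Γ (.refine A p) A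
  | refine {Γ : Ctx} {A B : Ty} {p₁ p₂ : Term} :
      Subtyping Γ A B → SemImp (.tm A :: Γ) p₁ p₂ →
      Subtyping Γ (.refine A p₁) (.refine B p₂)
  | tvarUpper {Γ : Ctx} {X : ℕ} {L U : Ty} :
      Ctx.lookupTy Γ X = some (L, U) → Subtyping Γ (.var X) U
  | tvarLower {Γ : Ctx} {X : ℕ} {L U : Ty} :
      Ctx.lookupTy Γ X = some (L, U) → Subtyping Γ L (.var X)
  | muUnfold (Γ : Ctx) {A : Ty} :
      A.spos 0 = true → Subtyping Γ (.mu A) (A.instTy (.mu A))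
  | muFold (Γ : Ctx) {A : Ty} :
      A.spos 0 = true → Subtyping Γ (A.instTy (.mu A)) (.mu A)
  | all {Γ : Ctx} {L₁ U₁ A L₂ U₂ B : Ty} :
      Subtyping Γ L₁ L₂ → Subtyping Γ U₂ U₁ → Subtyping (.ty L₂ U₂ :: Γ) A B →
      Subtyping Γ (.all L₁ U₁ A) (.all L₂ U₂ B)

/-- First-order types: base types with runtime equality, and refinements of these. -/
def Ty.firstorder : Ty → Prop
  | .unit | .tru | .fls | .int32 => True
  | .refine A _ => A.firstorder
  | _ => False

/-- Operand types of each operation. -/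
def Op.compat : Op → Ty → Prop
  | .eq, A | .ne, A => A.firstorder ∨ A = .bool
  | .and, A | .or, A => A = .bool
  | .lt, A | .le, A | .ge, A | .gt, A => A = .int32
  | .plus, A | .minus, A | .times, A | .quot, A | .rem, A => A = .int32

/-- Result type of each operation (for every operand type it accepts). -/
def Op.result : Op → Ty
  | .plus | .minus | .times | .quot | .rem => .int32
  | _ => .bool

/-- Syntactic typing `Γ ⊢ a : A`. -/
inductive Typing : Ctx → Term → Ty → Prop where
  | unit (Γ : Ctx) : Typing Γ (.const .unit) .unit
  | tru (Γ : Ctx) : Typing Γ .tt .tru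
  | fls (Γ : Ctx) : Typing Γ .ff .fls
  | int (Γ : Ctx) (z : ℤ) : Typing Γ (.const (.int z)) .int32
  | var {Γ : Ctx} {x : ℕ} {A : Ty} : Ctx.lookupTm Γ x = some A → Typing Γ (.var x) A
  | abs {Γ : Ctx} {A B : Ty} {b : Term} :
      Typing (.tm A :: Γ) b B → Typing Γ (.abs A b) (.pi A B)
  | app {Γ : Ctx} {f : Term} {y : ℕ} {A B : Ty} :
      Typing Γ f (.pi A B) → Typing Γ (.var y) A → Typing Γ (.app f (.var y)) (B.instTm y)
  | tabs {Γ : Ctx} {L U B : Ty} {b : Term} :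
      Typing (.ty L U :: Γ) b B → Typing Γ (.tabs L U b) (.all L U B)
  | tapp {Γ : Ctx} {f : Term} {L U A B : Ty} :
      Typing Γ f (.all L U B) → Subtyping Γ L A → Subtyping Γ A U →
      Typing Γ (.tapp f A) (B.instTy A)
  | letin {Γ : Ctx} {A B : Ty} {a b : Term} :
      Typing Γ a A →
      Typing (.fact (Ctx.depth Γ + 1) (.var 0) (Ctx.depth Γ) a :: .tm A :: Γ) b B →
      Typing Γ (.letin A a b) B.avoidTop
  | pair {Γ : Ctx} {y : ℕ} {a₂ : Term} {A B : Ty} :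
      Typing Γ (.var y) A → Typing Γ a₂ (B.instTm y) →
      Typing Γ (.pair (.var y) a₂) (.sigma A B)
  | binop {Γ : Ctx} {op : Op} {a b : Term} {A : Ty} :
      Typing Γ a A → Typing Γ b A → op.compat A → Typing Γ (.binop op a b) op.result
  | ite {Γ : Ctx} {a b₁ b₂ : Term} {B₁ B₂ : Ty} :
      Typing Γ a .bool →
      Typing (.fact (Ctx.depth Γ) a (Ctx.depth Γ) .tt :: Γ) b₁ B₁ →
      Typing (.fact (Ctx.depth Γ) a (Ctx.depth Γ) .ff :: Γ) b₂ B₂ →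
      Typing Γ (.ite a b₁ b₂) (.union B₁ B₂)
  | inl {Γ : Ctx} {a : Term} {A : Ty} (B : Ty) :
      Typing Γ a A → Typing Γ (.inl B a) (.sum A B)
  | inr {Γ : Ctx} {a : Term} (A : Ty) {B : Ty} :
      Typing Γ a B → Typing Γ (.inr A a) (.sum A B)
  | loop {Γ : Ctx} {a b : Term} {A B : Ty} :
      Typing Γ a A → Typing (.tm A :: Γ) b (Ty.sum A B).shiftTm → Typing Γ (.loop a b) B
  | self {Γ : Ctx} {a : Term} {A : Ty} :
      Typing Γ a A → A.firstorder →
      Typing Γ a (.refine A (.binop .eq (.var 0) a.shiftTm))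
  | sub {Γ : Ctx} {a : Term} {A B : Ty} :
      Typing Γ a A → Subtyping Γ A B → Typing Γ a B
  | matchPair {Γ : Ctx} {a b : Term} {A B C : Ty} :
      Typing Γ a (.sigma A B) → Typing (.tm B :: .tm A :: Γ) b C →
      Typing Γ (.matchPair a b) C.avoidTop.avoidTop
  | matchSum {Γ : Ctx} {a b₁ b₂ : Term} {A₁ A₂ B₁ B₂ : Ty} :
      Typing Γ a (.sum A₁ A₂) →
      Typing (.fact (Ctx.depth Γ) a (Ctx.depth Γ + 1) (.inl A₂.shiftTm (.var 0))
        :: .tm A₁ :: Γ) b₁ B₁ →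
      Typing (.fact (Ctx.depth Γ) a (Ctx.depth Γ + 1) (.inr A₁.shiftTm (.var 0))
        :: .tm A₂ :: Γ) b₂ B₂ →
      Typing Γ (.matchSum a b₁ b₂) (.union B₁.avoidTop B₂.avoidTop)

end RefCore

-- This is the fundamental lemma of a logical relation, by induction on the typing derivation with
-- `δ` and `ρ` universally quantified. Types are interpreted by structural recursion, and `Safe`
-- asks only for partial correctness. So it suffices to treat each fuel `n + 1`, where the
-- subevaluations run with fuel `n`, and no step-indexing is needed. Three semantic facts carry the
-- proof.
--
-- First, the interpretation commutes with renaming and with type substitution (`Ty.V_ren`,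
-- `Ty.V_sub`). An environment matters to a type only through its refinement predicates, which are
-- run. Renaming a predicate or changing its annotations changes the closures it creates, so results
-- agree only up to the relation `Value.Alike`. That relation relates `true` only to itself, so
-- membership in a refinement is unaffected.
--
-- Second, a strictly positive `A` commutes with nonempty intersections (`Ty.V_iff_forall_of_spos`).
-- Hence `A(⋂ Fⁿ) = ⋂ A(Fⁿ) = ⋂ Fⁿ⁺¹ = ⋂ Fⁿ`, the last step because `F⁰` is everything. These are
-- the fold and unfold rules. Binary intersections also give monotonicity.
--
-- Third, positive avoidance enlarges a type and negative avoidance shrinks it (`Ty.V_avoid`). For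
-- recursive types this compares the approximations one by one, using monotonicity of the original
-- body.
--
-- Subtyping is then inclusion of interpretations. In the typing rules, an equality fact is
-- witnessed by the very evaluation that has just succeeded.

namespace RefCore

/-! ## Evaluation: results and fuel -/

/-- A result that is not stuck and lies in `S` if it is not a timeout. -/
def Res.SafeIn (S : SemTy) (r : Res) : Prop := ∀ x, r = some x → ∃ v, x = some v ∧ S v

theorem safe_iff_safeIn {S : SemTy} {ρ : Env} {a : Term} :
    Safe S ρ a ↔ ∀ n, Res.SafeIn S (eval n ρ a) :=
  ⟨fun h n x hx => h x ⟨n, hx⟩, fun h x ⟨n, hx⟩ => h n x hx⟩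

/-- Fuel `0` is always a timeout. At fuel `n + 1` the interpreter unfolds once into subevaluations
of fuel `n`. -/
theorem safe_of_succ {S : SemTy} {ρ : Env} {a : Term}
    (h : ∀ n, Res.SafeIn S (eval (n + 1) ρ a)) : Safe S ρ a := by
  rintro x ⟨n, hx⟩
  cases n with
  | zero => simp [eval] at hx
  | succ n => exact h n x hx

theorem Res.SafeIn.value {S : SemTy} {v : Value} (h : S v) : Res.SafeIn S (some (some v)) := by
  rintro x ⟨⟩
  exact ⟨v, rfl, h⟩

/-- The continuation also receives the equation for `r`: it is the evidence from which the equality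
facts of `let`, `if` and `match` are established. -/
theorem Res.SafeIn.andThen {S T : SemTy} {r : Res} {k : Value → Res} (h : r.SafeIn S)
    (hk : ∀ v, r = some (some v) → S v → (k v).SafeIn T) : (r.andThen k).SafeIn T := by
  rcases r with _ | x
  · rintro x ⟨⟩
  · obtain ⟨v, rfl, hv⟩ := h x rfl
    exact hk v rfl hv

theorem Safe.mono {S T : SemTy} {ρ : Env} {a : Term} (h : Safe S ρ a) (hST : S.Incl T) :
    Safe T ρ a := fun x hx => by
  obtain ⟨v, rfl, hv⟩ := h x hx
  exact ⟨v, rfl, hST v hv⟩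

/-- Every result of `r` that is not a timeout is also the result of `r'`. -/
def Res.Le (r r' : Res) : Prop := ∀ x, r = some x → r' = some x

theorem Res.Le.refl (r : Res) : Res.Le r r := fun _ h => h

theorem Res.Le.andThen {r r' : Res} {k k' : Value → Res} (h : r.Le r')
    (hk : ∀ v, (k v).Le (k' v)) : (r.andThen k).Le (r'.andThen k') := by
  rcases r with _ | x
  · rintro x ⟨⟩
  · rw [h x rfl]
    rcases x with _ | v
    · exact Res.Le.refl _
    · exact hk v

/-- In a loop the fuel bounds both the evaluation of the body and the number of rounds, so both have
to grow together. -/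
theorem loopIter_le_succ {step step' : Value → Res} (h : ∀ v, (step v).Le (step' v)) (k : ℕ) :
    ∀ v, (loopIter step k v).Le (loopIter step' (k + 1) v) := by
  induction k with
  | zero => rintro v x ⟨⟩
  | succ k ih =>
    intro v
    refine Res.Le.andThen (h v) fun w => ?_
    cases w <;> first | exact ih _ | exact Res.Le.refl _

theorem eval_le_succ (n : ℕ) : ∀ ρ t, (eval n ρ t).Le (eval (n + 1) ρ t) := by
  induction n with
  | zero => rintro ρ t x ⟨⟩
  | succ n ih =>
    intro ρ t
    cases t with
    | const | var | abs | tabs => exact Res.Le.refl _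
    | app f a =>
      refine Res.Le.andThen (ih _ _) fun v => ?_
      cases v <;> first
        | exact Res.Le.andThen (ih _ _) fun _ => ih _ _
        | exact Res.Le.refl _
    | tapp f A =>
      refine Res.Le.andThen (ih _ _) fun v => ?_
      cases v <;> first | exact ih _ _ | exact Res.Le.refl _
    | letin A a b => exact Res.Le.andThen (ih _ _) fun _ => ih _ _
    | pair a b | binop op a b =>
      exact Res.Le.andThen (ih _ _) fun _ => Res.Le.andThen (ih _ _) fun _ => Res.Le.refl _
    | matchPair a b =>
      refine Res.Le.andThen (ih _ _) fun v => ?_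
      cases v <;> first | exact ih _ _ | exact Res.Le.refl _
    | matchSum a b c =>
      refine Res.Le.andThen (ih _ _) fun v => ?_
      cases v <;> first | exact ih _ _ | exact Res.Le.refl _
    | inl A a | inr A a => exact Res.Le.andThen (ih _ _) fun _ => Res.Le.refl _
    | ite a b c =>
      refine Res.Le.andThen (ih _ _) fun v => ?_
      split <;> first | exact ih _ _ | exact Res.Le.refl _
    | loop a b =>
      exact Res.Le.andThen (ih _ _) fun v => loopIter_le_succ (fun _ => ih _ _) _ v

theorem eval_le {n m : ℕ} (h : n ≤ m) (ρ : Env) (t : Term) : (eval n ρ t).Le (eval m ρ t) := by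
  induction h with
  | refl => exact Res.Le.refl _
  | step _ ih => exact fun x hx => eval_le_succ _ _ _ _ (ih x hx)

/-- Both runs persist at the larger of the two fuels, where the interpreter is a function. -/
theorem Terminates.unique {ρ : Env} {a : Term} {x y : Option Value}
    (hx : Terminates ρ a x) (hy : Terminates ρ a y) : x = y := by
  obtain ⟨n, hn⟩ := hx
  obtain ⟨m, hm⟩ := hy
  have h₁ := eval_le (le_max_left n m) ρ a x hn
  have h₂ := eval_le (le_max_right n m) ρ a y hm
  simpa using h₁.symm.trans h₂

/-! ## Evaluation ignores types and respects variable renaming -/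

/-- Lift a relation between variables under one binder. -/
def liftRel (r : ℕ → ℕ → Prop) : ℕ → ℕ → Prop
  | 0, 0 => True
  | x + 1, y + 1 => r x y
  | _, _ => False

/-- Two terms agree up to type annotations and the variable relation `r`. -/
inductive Term.Alike : (ℕ → ℕ → Prop) → Term → Term → Prop where
  | const {r} (c) : Alike r (.const c) (.const c)
  | var {r : ℕ → ℕ → Prop} {x y} : r x y → Alike r (.var x) (.var y)
  | abs {r A A' b b'} : Alike (liftRel r) b b' → Alike r (.abs A b) (.abs A' b')
  | app {r f f' a a'} : Alike r f f' → Alike r a a' → Alike r (.app f a) (.app f' a')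
  | tabs {r L L' U U' b b'} : Alike r b b' → Alike r (.tabs L U b) (.tabs L' U' b')
  | tapp {r f f' A A'} : Alike r f f' → Alike r (.tapp f A) (.tapp f' A')
  | letin {r A A' a a' b b'} : Alike r a a' → Alike (liftRel r) b b' →
      Alike r (.letin A a b) (.letin A' a' b')
  | pair {r a a' b b'} : Alike r a a' → Alike r b b' → Alike r (.pair a b) (.pair a' b')
  | matchPair {r a a' b b'} : Alike r a a' → Alike (liftRel (liftRel r)) b b' →
      Alike r (.matchPair a b) (.matchPair a' b')
  | matchSum {r a a' b b' c c'} : Alike r a a' → Alike (liftRel r) b b' →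
      Alike (liftRel r) c c' → Alike r (.matchSum a b c) (.matchSum a' b' c')
  | inl {r A A' a a'} : Alike r a a' → Alike r (.inl A a) (.inl A' a')
  | inr {r A A' a a'} : Alike r a a' → Alike r (.inr A a) (.inr A' a')
  | binop {r a a' b b'} (op) : Alike r a a' → Alike r b b' →
      Alike r (.binop op a b) (.binop op a' b')
  | ite {r a a' b b' c c'} : Alike r a a' → Alike r b b' → Alike r c c' →
      Alike r (.ite a b c) (.ite a' b' c')
  | loop {r a a' b b'} : Alike r a a' → Alike (liftRel r) b b' →
      Alike r (.loop a b) (.loop a' b')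

/-- Two values agree up to the representation of the closures in them. -/
inductive Value.Alike : Value → Value → Prop where
  | const (c) : Alike (.const c) (.const c)
  | pair {v v' w w'} : Alike v v' → Alike w w' → Alike (.pair v w) (.pair v' w')
  | inl {v v'} : Alike v v' → Alike (.inl v) (.inl v')
  | inr {v v'} : Alike v v' → Alike (.inr v) (.inr v')
  | clos {r : ℕ → ℕ → Prop} {ρ ρ' : Env} {b b'} :
      (∀ x y, r x y → Option.Rel Alike ρ[x]? ρ'[y]?) → Term.Alike (liftRel r) b b' →
      Alike (.clos ρ b) (.clos ρ' b')
  | tclos {r : ℕ → ℕ → Prop} {ρ ρ' : Env} {b b'} :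
      (∀ x y, r x y → Option.Rel Alike ρ[x]? ρ'[y]?) → Term.Alike r b b' →
      Alike (.tclos ρ b) (.tclos ρ' b')

/-- Related variables have related values. -/
def Env.Alike (r : ℕ → ℕ → Prop) (ρ ρ' : Env) : Prop :=
  ∀ x y, r x y → Option.Rel Value.Alike ρ[x]? ρ'[y]?

/-- Both results are timeouts, or both are stuck, or they are values that agree. -/
def Res.Alike : Res → Res → Prop := Option.Rel (Option.Rel Value.Alike)

theorem Env.Alike.cons {r : ℕ → ℕ → Prop} {ρ ρ' : Env} {v v' : Value} (h : Env.Alike r ρ ρ')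
    (hv : v.Alike v') : Env.Alike (liftRel r) (v :: ρ) (v' :: ρ') := by
  rintro (_ | x) (_ | y) hxy
  · exact .some hv
  · exact hxy.elim
  · exact hxy.elim
  · simpa using h x y hxy

theorem Res.Alike.andThen {r r' : Res} {k k' : Value → Res} (h : r.Alike r')
    (hk : ∀ v v', v.Alike v' → (k v).Alike (k' v')) : (r.andThen k).Alike (r'.andThen k') := by
  rcases h with @⟨_, _, h⟩ | _
  · rcases h with @⟨_, _, h⟩ | _
    · exact hk _ _ h
    · exact .some .none
  · exact .none

theorem Res.Alike.value {v v' : Value} (h : v.Alike v') :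
    Res.Alike (some (some v)) (some (some v')) := .some (.some h)

theorem Res.Alike.stuck : Res.Alike (some none) (some none) := .some .none

theorem loopIter_alike {step step' : Value → Res}
    (h : ∀ v v', v.Alike v' → (step v).Alike (step' v')) (k : ℕ) :
    ∀ v v', v.Alike v' → (loopIter step k v).Alike (loopIter step' k v') := by
  induction k with
  | zero => exact fun _ _ _ => .none
  | succ k ih =>
    intro v v' hv
    refine Res.Alike.andThen (h v v' hv) fun w w' hw => ?_
    cases hw with
    | inl hw => exact ih _ _ hw
    | inr hw => exact .value hw
    | const | pair | clos | tclos => exact .stuck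

/-- Operations inspect only constants, and a constant is alike only to itself. Every other shape is
stuck on both sides. -/
theorem Op.delta_alike (op : Op) {v v' w w' : Value} (hv : v.Alike v') (hw : w.Alike w') :
    Option.Rel Value.Alike (op.delta v w) (op.delta v' w') := by
  cases hv with
  | const c =>
    cases hw with
    | const d =>
      simp only [Op.delta]
      cases op.evalConst c d with
      | none => exact .none
      | some c => exact .some (.const c)
    | pair | inl | inr | clos | tclos => exact .none
  | pair | inl | inr | clos | tclos => exact .none

/-- Alike terms run in lockstep, so the fuel is the same on both sides and timeouts correspond too.
The variable relation is generalized in the induction because a closure body runs under the relation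
stored with that closure. -/
theorem eval_alike (n : ℕ) : ∀ {r t t' ρ ρ'}, Term.Alike r t t' → Env.Alike r ρ ρ' →
    (eval n ρ t).Alike (eval n ρ' t') := by
  induction n with
  | zero => exact fun _ _ => .none
  | succ n ih =>
    intro r t t' ρ ρ' ht hρ
    cases ht with
    | const c => exact .value (.const c)
    | var h => exact .some (hρ _ _ h)
    | abs hb => exact .value (.clos hρ hb)
    | tabs hb => exact .value (.tclos hρ hb)
    | app hf ha =>
      refine (ih hf hρ).andThen fun v v' hv => ?_
      cases hv with
      | clos hρf hb => exact (ih ha hρ).andThen fun w w' hw => ih hb (Env.Alike.cons hρf hw)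
      | const | pair | inl | inr | tclos => exact .stuck
    | tapp hf =>
      refine (ih hf hρ).andThen fun v v' hv => ?_
      cases hv with
      | tclos hρf hb => exact ih hb hρf
      | const | pair | inl | inr | clos => exact .stuck
    | letin ha hb => exact (ih ha hρ).andThen fun v v' hv => ih hb (hρ.cons hv)
    | pair ha hb =>
      exact (ih ha hρ).andThen fun v v' hv => (ih hb hρ).andThen fun w w' hw =>
        .value (.pair hv hw)
    | matchPair ha hb =>
      refine (ih ha hρ).andThen fun v v' hv => ?_
      cases hv with
      | pair hv hw => exact ih hb ((hρ.cons hv).cons hw)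
      | const | inl | inr | clos | tclos => exact .stuck
    | matchSum ha hb hc =>
      refine (ih ha hρ).andThen fun v v' hv => ?_
      cases hv with
      | inl hv => exact ih hb (hρ.cons hv)
      | inr hv => exact ih hc (hρ.cons hv)
      | const | pair | clos | tclos => exact .stuck
    | inl ha => exact (ih ha hρ).andThen fun v v' hv => .value (.inl hv)
    | inr ha => exact (ih ha hρ).andThen fun v v' hv => .value (.inr hv)
    | binop op ha hb =>
      exact (ih ha hρ).andThen fun v v' hv => (ih hb hρ).andThen fun w w' hw =>
        .some (op.delta_alike hv hw)
    | ite ha hb hc =>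
      refine (ih ha hρ).andThen fun v v' hv => ?_
      cases hv with
      | const c =>
        rcases c with _ | (_ | _) | _
        · exact .stuck
        · exact ih hc hρ
        · exact ih hb hρ
        · exact .stuck
      | pair | inl | inr | clos | tclos => exact .stuck
    | loop ha hb =>
      exact (ih ha hρ).andThen fun v v' hv =>
        loopIter_alike (fun _ _ hw => ih hb (hρ.cons hw)) n _ _ hv

theorem liftRel_hasTm {P : ℕ → Prop} {r : ℕ → ℕ → Prop} {ξ : ℕ → ℕ}
    (h : ∀ x, P (x + 1) → r x (ξ x)) (x : ℕ) (hx : P x) : liftRel r x (liftRen ξ x) := by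
  cases x with
  | zero => trivial
  | succ x => exact h x hx

/-- Only variables that occur need to be related. This allows renamings that are wrong at an absent
variable, such as `Nat.pred` at `0` in `Ty.lowerTm`. -/
theorem Term.alike_ren : ∀ (t : Term) {r : ℕ → ℕ → Prop} {τ ξ : ℕ → ℕ},
    (∀ x, t.hasTm x = true → r x (ξ x)) → Term.Alike r t (t.ren τ ξ)
  | .const c, _, _, _, _ => .const c
  | .var x, _, _, _, h => .var (h x (by simp [Term.hasTm]))
  | .abs _ b, _, _, _, h => .abs (b.alike_ren (liftRel_hasTm fun x hx => h x (by
      simp [Term.hasTm, hx])))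
  | .app f a, _, _, _, h => .app (f.alike_ren fun x hx => h x (by simp [Term.hasTm, hx]))
      (a.alike_ren fun x hx => h x (by simp [Term.hasTm, hx]))
  | .tabs _ _ b, _, _, _, h => .tabs (b.alike_ren fun x hx => h x (by simp [Term.hasTm, hx]))
  | .tapp f _, _, _, _, h => .tapp (f.alike_ren fun x hx => h x (by simp [Term.hasTm, hx]))
  | .letin _ a b, _, _, _, h => .letin (a.alike_ren fun x hx => h x (by simp [Term.hasTm, hx]))
      (b.alike_ren (liftRel_hasTm fun x hx => h x (by simp [Term.hasTm, hx])))
  | .pair a b, _, _, _, h => .pair (a.alike_ren fun x hx => h x (by simp [Term.hasTm, hx]))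
      (b.alike_ren fun x hx => h x (by simp [Term.hasTm, hx]))
  | .matchPair a b, _, _, _, h =>
      .matchPair (a.alike_ren fun x hx => h x (by simp [Term.hasTm, hx]))
        -- Two binders are crossed, and the explicit `P` is the occurrence predicate between them.
        (b.alike_ren (liftRel_hasTm (liftRel_hasTm (P := fun x => b.hasTm (x + 1) = true)
          fun x hx => h x (by simp [Term.hasTm, hx]))))
  | .matchSum a b c, _, _, _, h =>
      .matchSum (a.alike_ren fun x hx => h x (by simp [Term.hasTm, hx]))
        (b.alike_ren (liftRel_hasTm fun x hx => h x (by simp [Term.hasTm, hx])))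
        (c.alike_ren (liftRel_hasTm fun x hx => h x (by simp [Term.hasTm, hx])))
  | .inl _ a, _, _, _, h => .inl (a.alike_ren fun x hx => h x (by simp [Term.hasTm, hx]))
  | .inr _ a, _, _, _, h => .inr (a.alike_ren fun x hx => h x (by simp [Term.hasTm, hx]))
  | .binop op a b, _, _, _, h =>
      .binop op (a.alike_ren fun x hx => h x (by simp [Term.hasTm, hx]))
        (b.alike_ren fun x hx => h x (by simp [Term.hasTm, hx]))
  | .ite a b c, _, _, _, h => .ite (a.alike_ren fun x hx => h x (by simp [Term.hasTm, hx]))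
      (b.alike_ren fun x hx => h x (by simp [Term.hasTm, hx]))
      (c.alike_ren fun x hx => h x (by simp [Term.hasTm, hx]))
  | .loop a b, _, _, _, h => .loop (a.alike_ren fun x hx => h x (by simp [Term.hasTm, hx]))
      (b.alike_ren (liftRel_hasTm fun x hx => h x (by simp [Term.hasTm, hx])))

/-- `liftRel Eq` is not literally `Eq`, but reflexivity passes under binders; hence the reflexivity
hypothesis in the lemmas below. -/
theorem liftRel_self {r : ℕ → ℕ → Prop} (h : ∀ x, r x x) (x : ℕ) : liftRel r x x := by
  cases x with
  | zero => trivial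
  | succ x => exact h x

theorem Term.alike_sub : ∀ (t : Term) {r : ℕ → ℕ → Prop} {σ : ℕ → Ty}, (∀ x, r x x) →
    Term.Alike r t (t.sub σ)
  | .const c, _, _, _ => .const c
  | .var x, _, _, h => .var (h x)
  | .abs _ b, _, _, h => .abs (b.alike_sub (liftRel_self h))
  | .app f a, _, _, h => .app (f.alike_sub h) (a.alike_sub h)
  | .tabs _ _ b, _, _, h => .tabs (b.alike_sub h)
  | .tapp f _, _, _, h => .tapp (f.alike_sub h)
  | .letin _ a b, _, _, h => .letin (a.alike_sub h) (b.alike_sub (liftRel_self h))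
  | .pair a b, _, _, h => .pair (a.alike_sub h) (b.alike_sub h)
  | .matchPair a b, _, _, h =>
      .matchPair (a.alike_sub h) (b.alike_sub (liftRel_self (liftRel_self h)))
  | .matchSum a b c, _, _, h => .matchSum (a.alike_sub h) (b.alike_sub (liftRel_self h))
      (c.alike_sub (liftRel_self h))
  | .inl _ a, _, _, h => .inl (a.alike_sub h)
  | .inr _ a, _, _, h => .inr (a.alike_sub h)
  | .binop op a b, _, _, h => .binop op (a.alike_sub h) (b.alike_sub h)
  | .ite a b c, _, _, h => .ite (a.alike_sub h) (b.alike_sub h) (c.alike_sub h)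
  | .loop a b, _, _, h => .loop (a.alike_sub h) (b.alike_sub (liftRel_self h))

theorem Term.alike_refl : ∀ (t : Term) {r : ℕ → ℕ → Prop}, (∀ x, r x x) → Term.Alike r t t
  | .const c, _, _ => .const c
  | .var x, _, h => .var (h x)
  | .abs _ b, _, h => .abs (b.alike_refl (liftRel_self h))
  | .app f a, _, h => .app (f.alike_refl h) (a.alike_refl h)
  | .tabs _ _ b, _, h => .tabs (b.alike_refl h)
  | .tapp f _, _, h => .tapp (f.alike_refl h)
  | .letin _ a b, _, h => .letin (a.alike_refl h) (b.alike_refl (liftRel_self h))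
  | .pair a b, _, h => .pair (a.alike_refl h) (b.alike_refl h)
  | .matchPair a b, _, h =>
      .matchPair (a.alike_refl h) (b.alike_refl (liftRel_self (liftRel_self h)))
  | .matchSum a b c, _, h => .matchSum (a.alike_refl h) (b.alike_refl (liftRel_self h))
      (c.alike_refl (liftRel_self h))
  | .inl _ a, _, h => .inl (a.alike_refl h)
  | .inr _ a, _, h => .inr (a.alike_refl h)
  | .binop op a b, _, h => .binop op (a.alike_refl h) (b.alike_refl h)
  | .ite a b c, _, h => .ite (a.alike_refl h) (b.alike_refl h) (c.alike_refl h)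
  | .loop a b, _, h => .loop (a.alike_refl h) (b.alike_refl (liftRel_self h))

mutual

theorem Value.alike_refl : ∀ v : Value, v.Alike v
  | .const c => .const c
  | .pair v w => .pair v.alike_refl w.alike_refl
  | .inl v => .inl v.alike_refl
  | .inr v => .inr v.alike_refl
  | .clos ρ b => .clos (r := Eq) (fun x _ h => h ▸ Env.alike_refl ρ x)
      (b.alike_refl (liftRel_self fun _ => rfl))
  | .tclos ρ b => .tclos (r := Eq) (fun x _ h => h ▸ Env.alike_refl ρ x)
      (b.alike_refl fun _ => rfl)

theorem Env.alike_refl : ∀ (ρ : List Value) (x : ℕ), Option.Rel Value.Alike ρ[x]? ρ[x]?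
  | [], _ => .none
  | v :: _, 0 => .some v.alike_refl
  | _ :: ρ, x + 1 => by simpa using Env.alike_refl ρ x

end

theorem Env.Alike.of_eq {r : ℕ → ℕ → Prop} {ρ ρ' : Env}
    (h : ∀ x y, r x y → ρ[x]? = ρ'[y]?) : Env.Alike r ρ ρ' :=
  fun x y hxy => h x y hxy ▸ Env.alike_refl ρ x

theorem Terminates.alike {r : ℕ → ℕ → Prop} {t t' : Term} {ρ ρ' : Env} {x : Option Value}
    (ht : Term.Alike r t t') (hρ : Env.Alike r ρ ρ') (h : Terminates ρ t x) :
    ∃ y, Terminates ρ' t' y ∧ Option.Rel Value.Alike x y := by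
  obtain ⟨n, hn⟩ := h
  have := eval_alike n ht hρ
  rw [hn] at this
  generalize hy : eval n ρ' t' = y at this
  cases this with
  | some h => exact ⟨_, ⟨n, hy⟩, h⟩

/-- The converse direction, read off the same lockstep run instead of from symmetry of the relation.
-/
theorem Terminates.alike' {r : ℕ → ℕ → Prop} {t t' : Term} {ρ ρ' : Env} {y : Option Value}
    (ht : Term.Alike r t t') (hρ : Env.Alike r ρ ρ') (h : Terminates ρ' t' y) :
    ∃ x, Terminates ρ t x ∧ Option.Rel Value.Alike x y := by
  obtain ⟨n, hn⟩ := h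
  have := eval_alike n ht hρ
  rw [hn] at this
  generalize hx : eval n ρ t = x at this
  cases this with
  | some h => exact ⟨_, ⟨n, hx⟩, h⟩

/-- The set `{true}` cannot distinguish alike values, so the slack in closures disappears exactly
where predicates are tested. -/
theorem safe_semTrue_iff_of_alike {r : ℕ → ℕ → Prop} {t t' : Term} {ρ ρ' : Env}
    (ht : Term.Alike r t t') (hρ : Env.Alike r ρ ρ') :
    Safe semTrue ρ t ↔ Safe semTrue ρ' t' := by
  constructor
  · intro h y hy
    obtain ⟨x, hx, hxy⟩ := hy.alike' ht hρ
    obtain ⟨v, rfl, rfl⟩ := h x hx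
    rcases hxy with @⟨_, _, h⟩
    cases h
    exact ⟨_, rfl, rfl⟩
  · intro h y hy
    obtain ⟨x, hx, hxy⟩ := hy.alike ht hρ
    obtain ⟨v, rfl, rfl⟩ := h x hx
    rcases hxy with @⟨_, _, h⟩
    cases h
    exact ⟨_, rfl, rfl⟩

/-! ## The value interpretation under renaming and substitution -/

theorem getElem?_cons_liftRen {P : ℕ → Prop} {ξ : ℕ → ℕ} {ρ ρ' : Env} (v : Value)
    (h : ∀ x, P (x + 1) → ρ'[ξ x]? = ρ[x]?) (x : ℕ) (hx : P x) :
    (v :: ρ')[liftRen ξ x]? = (v :: ρ)[x]? := by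
  cases x with
  | zero => rfl
  | succ x => simpa [liftRen] using h x hx

theorem TyEnv.cons_liftRen {τ : ℕ → ℕ} {δ δ' : TyEnv} (S : SemTy) (h : ∀ X, δ' (τ X) = δ X)
    (X : ℕ) : δ'.cons S (liftRen τ X) = δ.cons S X := by
  cases X with
  | zero => rfl
  | succ X => exact h X

/-- The values themselves are not renamed: closures run in their own environments. The two
environments of the type are compared only when a refinement predicate is run, and they need to
agree only on variables that occur. -/
theorem Ty.V_ren : ∀ (A : Ty) {τ ξ : ℕ → ℕ} {δ δ' : TyEnv} {ρ ρ' : Env},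
    (∀ X, δ' (τ X) = δ X) → (∀ x, A.hasTm x = true → ρ'[ξ x]? = ρ[x]?) →
    (A.ren τ ξ).V δ' ρ' = A.V δ ρ
  | .var X, _, _, _, _, _, _, hτ, _ => hτ X
  | .unit, _, _, _, _, _, _, _, _ => rfl
  | .tru, _, _, _, _, _, _, _, _ => rfl
  | .fls, _, _, _, _, _, _, _, _ => rfl
  | .int32, _, _, _, _, _, _, _, _ => rfl
  | .top, _, _, _, _, _, _, _, _ => rfl
  | .bot, _, _, _, _, _, _, _, _ => rfl
  | .pi A B, _, _, _, _, _, _, hτ, hξ => by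
    have hA := A.V_ren hτ fun x hx => hξ x (by simp [Ty.hasTm, hx])
    have hB := fun va => B.V_ren hτ
      (getElem?_cons_liftRen va fun x hx => hξ x (by simp [Ty.hasTm, hx]))
    simp only [Ty.ren, Ty.V, hA, hB]
  | .all L U B, _, _, _, _, _, _, hτ, hξ => by
    have hL := L.V_ren hτ fun x hx => hξ x (by simp [Ty.hasTm, hx])
    have hU := U.V_ren hτ fun x hx => hξ x (by simp [Ty.hasTm, hx])
    have hB := fun S => B.V_ren (TyEnv.cons_liftRen S hτ) fun x hx => hξ x (by simp [Ty.hasTm, hx])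
    simp only [Ty.ren, Ty.V, hL, hU, hB]
  | .sigma A B, _, _, _, _, _, _, hτ, hξ => by
    have hA := A.V_ren hτ fun x hx => hξ x (by simp [Ty.hasTm, hx])
    have hB := fun va => B.V_ren hτ
      (getElem?_cons_liftRen va fun x hx => hξ x (by simp [Ty.hasTm, hx]))
    simp only [Ty.ren, Ty.V, hA, hB]
  | .sum A B, _, _, _, _, _, _, hτ, hξ | .union A B, _, _, _, _, _, _, hτ, hξ
  | .inter A B, _, _, _, _, _, _, hτ, hξ => by
    have hA := A.V_ren hτ fun x hx => hξ x (by simp [Ty.hasTm, hx])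
    have hB := B.V_ren hτ fun x hx => hξ x (by simp [Ty.hasTm, hx])
    simp only [Ty.ren, Ty.V, hA, hB]
  | .refine A p, τ, ξ, _, _, ρ, ρ', hτ, hξ => by
    have hA := A.V_ren hτ fun x hx => hξ x (by simp [Ty.hasTm, hx])
    have hp : ∀ v, Safe semTrue (v :: ρ) p ↔ Safe semTrue (v :: ρ') (p.ren τ (liftRen ξ)) :=
      fun v => safe_semTrue_iff_of_alike
        (p.alike_ren (r := fun x y => p.hasTm x = true ∧ y = liftRen ξ x) fun x hx => ⟨hx, rfl⟩)
        (.of_eq (by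
          rintro x _ ⟨hx, rfl⟩
          exact (getElem?_cons_liftRen (P := fun x => p.hasTm x = true) v
            (fun x hx => hξ x (by simp [Ty.hasTm, hx])) x hx).symm))
    simp only [Ty.ren, Ty.V, hA, hp]
  | .mu A, _, _, _, _, _, _, hτ, hξ => by
    have hA := fun S => A.V_ren (TyEnv.cons_liftRen S hτ) fun x hx => hξ x (by simp [Ty.hasTm, hx])
    simp only [Ty.ren, Ty.V, hA]

theorem Ty.V_shiftTm (A : Ty) (δ : TyEnv) (ρ : Env) (v : Value) :
    A.shiftTm.V δ (v :: ρ) = A.V δ ρ :=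
  A.V_ren (fun _ => rfl) fun x _ => by simp

theorem Ty.V_shiftTy (A : Ty) (δ : TyEnv) (S : SemTy) (ρ : Env) :
    A.shiftTy.V (δ.cons S) ρ = A.V δ ρ :=
  A.V_ren (fun _ => rfl) fun _ _ => rfl

/-- Arguments in dependent positions are variables, so instantiation is a renaming and the value is
already in the environment. -/
theorem Ty.V_instTm (B : Ty) (δ : TyEnv) {ρ : Env} {y : ℕ} {v : Value} (hy : ρ[y]? = some v) :
    (B.instTm y).V δ ρ = B.V δ (v :: ρ) :=
  B.V_ren (fun _ => rfl) fun x _ => by cases x <;> simp [hy]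

theorem Ty.V_sub : ∀ (A : Ty) {σ : ℕ → Ty} {δ δ' : TyEnv} {ρ : Env},
    (∀ X, (σ X).V δ ρ = δ' X) → (A.sub σ).V δ ρ = A.V δ' ρ
  | .var X, _, _, _, _, h => h X
  | .unit, _, _, _, _, _ => rfl
  | .tru, _, _, _, _, _ => rfl
  | .fls, _, _, _, _, _ => rfl
  | .int32, _, _, _, _, _ => rfl
  | .top, _, _, _, _, _ => rfl
  | .bot, _, _, _, _, _ => rfl
  | .pi A B, _, _, _, _, h | .sigma A B, _, _, _, _, h => by
    have hA := A.V_sub h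
    have hB := fun va => B.V_sub (σ := liftSubTm _) fun X => (Ty.V_shiftTm _ _ _ va).trans (h X)
    simp only [Ty.sub, Ty.V, hA, hB]
  | .all L U B, σ, δ, δ', ρ, h => by
    have hL := L.V_sub h
    have hU := U.V_sub h
    have hB : ∀ S, (B.sub (liftSubTy σ)).V (δ.cons S) ρ = B.V (δ'.cons S) ρ :=
      fun S => B.V_sub fun X => by
        cases X with
        | zero => rfl
        | succ X => exact (Ty.V_shiftTy _ _ _ _).trans (h X)
    simp only [Ty.sub, Ty.V, hL, hU, hB]
  | .sum A B, _, _, _, _, h | .union A B, _, _, _, _, h | .inter A B, _, _, _, _, h => by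
    have hA := A.V_sub h
    have hB := B.V_sub h
    simp only [Ty.sub, Ty.V, hA, hB]
  -- Type substitution changes only the annotations in `p`, which evaluation ignores.
  | .refine A p, σ, _, _, ρ, h => by
    have hA := A.V_sub h
    have hp : ∀ v, Safe semTrue (v :: ρ) p ↔ Safe semTrue (v :: ρ) (p.sub (liftSubTm σ)) :=
      fun v => safe_semTrue_iff_of_alike (p.alike_sub (r := Eq) fun _ => rfl)
        (.of_eq fun _ _ h => h ▸ rfl)
    simp only [Ty.sub, Ty.V, hA, hp]
  | .mu A, σ, δ, δ', ρ, h => by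
    have hA : ∀ S, (A.sub (liftSubTy σ)).V (δ.cons S) ρ = A.V (δ'.cons S) ρ :=
      fun S => A.V_sub fun X => by
        cases X with
        | zero => rfl
        | succ X => exact (Ty.V_shiftTy _ _ _ _).trans (h X)
    simp only [Ty.sub, Ty.V, hA]

theorem Ty.V_instTy (B A : Ty) (δ : TyEnv) (ρ : Env) :
    (B.instTy A).V δ ρ = B.V (δ.cons (A.V δ ρ)) ρ :=
  B.V_sub fun X => by cases X <;> rfl

theorem TyEnv.cons_eq_cons {P : ℕ → Prop} {δ δ' : TyEnv} (S : SemTy)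
    (h : ∀ X, P (X + 1) → δ X = δ' X) (X : ℕ) (hX : P X) : δ.cons S X = δ'.cons S X := by
  cases X with
  | zero => rfl
  | succ X => exact h X hX

theorem Ty.V_congr : ∀ (A : Ty) {δ δ' : TyEnv} {ρ : Env},
    (∀ X, A.hasTy X = true → δ X = δ' X) → A.V δ ρ = A.V δ' ρ
  | .var X, _, _, _, h => h X (by simp [Ty.hasTy])
  | .unit, _, _, _, _ => rfl
  | .tru, _, _, _, _ => rfl
  | .fls, _, _, _, _ => rfl
  | .int32, _, _, _, _ => rfl
  | .top, _, _, _, _ => rfl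
  | .bot, _, _, _, _ => rfl
  | .pi A B, δ, δ', ρ, h | .sigma A B, δ, δ', ρ, h => by
    have hA : A.V δ ρ = A.V δ' ρ := A.V_congr fun X hX => h X (by simp [Ty.hasTy, hX])
    have hB : ∀ va, B.V δ (va :: ρ) = B.V δ' (va :: ρ) :=
      fun va => B.V_congr fun X hX => h X (by simp [Ty.hasTy, hX])
    simp only [Ty.V, hA, hB]
  | .all L U B, δ, δ', ρ, h => by
    have hL : L.V δ ρ = L.V δ' ρ := L.V_congr fun X hX => h X (by simp [Ty.hasTy, hX])
    have hU : U.V δ ρ = U.V δ' ρ := U.V_congr fun X hX => h X (by simp [Ty.hasTy, hX])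
    have hB : ∀ S, B.V (δ.cons S) ρ = B.V (δ'.cons S) ρ :=
      fun S => B.V_congr (TyEnv.cons_eq_cons S fun X hX => h X (by simp [Ty.hasTy, hX]))
    simp only [Ty.V, hL, hU, hB]
  | .sum A B, δ, δ', ρ, h | .union A B, δ, δ', ρ, h | .inter A B, δ, δ', ρ, h => by
    have hA : A.V δ ρ = A.V δ' ρ := A.V_congr fun X hX => h X (by simp [Ty.hasTy, hX])
    have hB : B.V δ ρ = B.V δ' ρ := B.V_congr fun X hX => h X (by simp [Ty.hasTy, hX])
    simp only [Ty.V, hA, hB]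
  -- The predicate is run in `ρ` alone, so `δ` enters only through `A`.
  | .refine A p, δ, δ', ρ, h => by
    have hA : A.V δ ρ = A.V δ' ρ := A.V_congr fun X hX => h X (by simp [Ty.hasTy, hX])
    simp only [Ty.V, hA]
  | .mu A, δ, δ', ρ, h => by
    have hA : ∀ S, A.V (δ.cons S) ρ = A.V (δ'.cons S) ρ :=
      fun S => A.V_congr (TyEnv.cons_eq_cons S fun X hX => h X (by simp [Ty.hasTy, hX]))
    simp only [Ty.V, hA]

/-! ## Strictly positive types commute with intersections -/

/-- `δ` maps `X` to the intersection of the `δs i X` and agrees with every `δs i` elsewhere. -/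
structure TyEnv.IsInterAt {ι : Type} (X : ℕ) (δ : TyEnv) (δs : ι → TyEnv) : Prop where
  at_self : ∀ v, δ X v ↔ ∀ i, δs i X v
  of_ne : ∀ Y, Y ≠ X → ∀ i, δs i Y = δ Y

theorem TyEnv.IsInterAt.cons {ι : Type} {X : ℕ} {δ : TyEnv} {δs : ι → TyEnv}
    (h : TyEnv.IsInterAt X δ δs) (S : SemTy) :
    TyEnv.IsInterAt (X + 1) (δ.cons S) fun i => (δs i).cons S where
  at_self := h.at_self
  of_ne Y hY i := by
    cases Y with
    | zero => rfl
    | succ Y => exact h.of_ne Y (by omega) i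

theorem TyEnv.IsInterAt.V_eq {ι : Type} {X : ℕ} {δ : TyEnv} {δs : ι → TyEnv}
    (h : TyEnv.IsInterAt X δ δs) {A : Ty} (hA : A.hasTy X = false) (ρ : Env) (i : ι) :
    A.V (δs i) ρ = A.V δ ρ :=
  A.V_congr fun Y hY => h.of_ne Y (by rintro rfl; simp [hA] at hY) i

/-- One index suffices to exclude a stuck result. The resulting value does not depend on the index,
so it lies in every `T i`. -/
theorem safe_forall_iff {ι : Type} [Nonempty ι] {S : SemTy} {T : ι → SemTy}
    (h : ∀ v, S v ↔ ∀ i, T i v) (ρ : Env) (a : Term) :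
    Safe S ρ a ↔ ∀ i, Safe (T i) ρ a := by
  refine ⟨fun ha i => ha.mono fun v hv => (h v).1 hv i, fun ha x hx => ?_⟩
  obtain ⟨v, rfl, -⟩ := ha (Classical.arbitrary ι) x hx
  refine ⟨v, rfl, (h v).2 fun i => ?_⟩
  obtain ⟨w, ⟨⟩, hw⟩ := ha i _ hx
  exact hw

/-- The shape of `v` fixes the existential witnesses (closure, components, tag) independently of
`i`, so quantifiers over `i` move inward. Nonemptiness supplies one member from which to read off
that shape. Domains and bounds do not mention `X` and are constant in `i`. -/
theorem Ty.V_iff_forall_of_spos {ι : Type} [Nonempty ι] : ∀ (A : Ty) {X : ℕ} {δ : TyEnv}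
    {δs : ι → TyEnv} (_ : A.spos X = true) (_ : TyEnv.IsInterAt X δ δs) (ρ : Env) (v : Value),
    A.V δ ρ v ↔ ∀ i, A.V (δs i) ρ v
  | .var Y, X, δ, δs, _, h, ρ, v => by
    by_cases hY : Y = X
    · subst hY
      exact h.at_self v
    · simp [Ty.V, h.of_ne Y hY]
  | .unit, _, _, _, _, _, _, _ => by simp [Ty.V]
  | .tru, _, _, _, _, _, _, _ => by simp [Ty.V]
  | .fls, _, _, _, _, _, _, _ => by simp [Ty.V]
  | .int32, _, _, _, _, _, _, _ => by simp [Ty.V]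
  | .top, _, _, _, _, _, _, _ => by simp [Ty.V]
  | .bot, _, _, _, _, _, _, _ => by simp [Ty.V]
  | .pi A B, X, δ, δs, hp, h, ρ, v => by
    simp only [Ty.spos, Bool.and_eq_true, Bool.not_eq_true'] at hp
    have hA := h.V_eq hp.1 ρ
    have hB := fun va b ρf => safe_forall_iff (B.V_iff_forall_of_spos hp.2 h (va :: ρ)) ρf b
    simp only [Ty.V, hA, hB]
    constructor
    · rintro ⟨ρf, b, rfl, hv⟩ i
      exact ⟨ρf, b, rfl, fun va hva => hv va hva i⟩
    · intro hv
      obtain ⟨ρf, b, rfl, -⟩ := hv (Classical.arbitrary ι)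
      refine ⟨ρf, b, rfl, fun va hva i => ?_⟩
      obtain ⟨_, _, ⟨⟩, hv⟩ := hv i
      exact hv va hva
  | .all L U B, X, δ, δs, hp, h, ρ, v => by
    simp only [Ty.spos, Bool.and_eq_true, Bool.not_eq_true'] at hp
    have hL := h.V_eq hp.1.1 ρ
    have hU := h.V_eq hp.1.2 ρ
    have hB := fun S b ρf => safe_forall_iff (B.V_iff_forall_of_spos hp.2 (h.cons S) ρ) ρf b
    simp only [Ty.V, hL, hU, hB]
    constructor
    · rintro ⟨ρf, b, rfl, hv⟩ i
      exact ⟨ρf, b, rfl, fun S h₁ h₂ => hv S h₁ h₂ i⟩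
    · intro hv
      obtain ⟨ρf, b, rfl, -⟩ := hv (Classical.arbitrary ι)
      refine ⟨ρf, b, rfl, fun S h₁ h₂ i => ?_⟩
      obtain ⟨_, _, ⟨⟩, hv⟩ := hv i
      exact hv S h₁ h₂
  | .sigma A B, X, δ, δs, hp, h, ρ, v => by
    simp only [Ty.spos, Bool.and_eq_true] at hp
    have hA := A.V_iff_forall_of_spos hp.1 h ρ
    have hB := fun va => B.V_iff_forall_of_spos hp.2 h (va :: ρ)
    simp only [Ty.V, hA, hB]
    constructor
    · rintro ⟨v₁, v₂, rfl, h₁, h₂⟩ i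
      exact ⟨v₁, v₂, rfl, h₁ i, h₂ i⟩
    · intro hv
      obtain ⟨v₁, v₂, rfl, -⟩ := hv (Classical.arbitrary ι)
      refine ⟨v₁, v₂, rfl, fun i => ?_, fun i => ?_⟩ <;>
        obtain ⟨_, _, ⟨⟩, h₁, h₂⟩ := hv i
      · exact h₁
      · exact h₂
  | .sum A B, X, δ, δs, hp, h, ρ, v => by
    simp only [Ty.spos, Bool.and_eq_true] at hp
    have hA := A.V_iff_forall_of_spos hp.1 h ρ
    have hB := B.V_iff_forall_of_spos hp.2 h ρ
    simp only [Ty.V]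
    -- The tag of `v` selects one summand, the same for all `i`.
    cases v <;> simp [hA, hB]
  | .refine A p, X, δ, δs, hp, h, ρ, v => by
    simp only [Ty.spos] at hp
    simp only [Ty.V, A.V_iff_forall_of_spos hp h ρ, forall_and, forall_const]
  -- Unions do not commute with intersections in general: different `i` could use different sides.
  -- Both sides are therefore constant in `X`.
  | .union A B, X, δ, δs, hp, h, ρ, v => by
    simp only [Ty.spos, Bool.and_eq_true, Bool.not_eq_true'] at hp
    simp only [Ty.V, h.V_eq hp.1 ρ, h.V_eq hp.2 ρ, forall_const]
  | .inter A B, X, δ, δs, hp, h, ρ, v => by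
    simp only [Ty.spos, Bool.and_eq_true] at hp
    simp only [Ty.V, A.V_iff_forall_of_spos hp.1 h ρ, B.V_iff_forall_of_spos hp.2 h ρ, forall_and]
  | .mu A, X, δ, δs, hp, h, ρ, v => by
    simp only [Ty.spos, Bool.and_eq_true, Bool.not_eq_true'] at hp
    have hA : ∀ i, (Ty.mu A).V (δs i) ρ = (Ty.mu A).V δ ρ :=
      h.V_eq (by simpa only [Ty.hasTy] using hp.2) ρ
    simp only [hA, forall_const]

/-- If `S ⊆ T` then `S = S ∩ T`, and commuting with this two-member intersection gives monotonicity.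
-/
theorem Ty.V_mono_of_spos {A : Ty} (hA : A.spos 0 = true) (δ : TyEnv) (ρ : Env) {S T : SemTy}
    (h : S.Incl T) : (A.V (δ.cons S) ρ).Incl (A.V (δ.cons T) ρ) := by
  have hI : TyEnv.IsInterAt 0 (δ.cons S) fun b : Bool => δ.cons (if b then S else T) := by
    refine ⟨fun v => ?_, fun Y hY i => ?_⟩
    · simpa [TyEnv.cons] using h v
    · cases Y with
      | zero => exact absurd rfl hY
      | succ Y => rfl
  intro v hv
  simpa using (A.V_iff_forall_of_spos hA hI ρ v).1 hv false

theorem Ty.V_mu_instTy {A : Ty} (hA : A.spos 0 = true) (δ : TyEnv) (ρ : Env) (v : Value) :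
    (A.instTy (.mu A)).V δ ρ v ↔ (Ty.mu A).V δ ρ v := by
  have hI : TyEnv.IsInterAt 0 (δ.cons ((Ty.mu A).V δ ρ))
      fun n => δ.cons (approx (fun S => A.V (δ.cons S) ρ) n) := by
    refine ⟨fun v => Iff.rfl, fun Y hY i => ?_⟩
    cases Y with
    | zero => exact absurd rfl hY
    | succ Y => rfl
  rw [Ty.V_instTy, A.V_iff_forall_of_spos hA hI ρ v]
  -- After commuting, the unfolded type is the intersection of the approximations from index `1` on.
  -- The missing one, at index `0`, is everything.
  refine ⟨fun h n => ?_, fun h n => h (n + 1)⟩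
  cases n with
  | zero => trivial
  | succ n => exact h n

/-! ## Avoidance -/

theorem safe_tt (ρ : Env) : Safe semTrue ρ .tt :=
  safe_of_succ fun _ => .value rfl

theorem not_safe_ff (ρ : Env) : ¬ Safe semTrue ρ .ff := fun h => by
  obtain ⟨v, ⟨⟩, hv⟩ := h _ ⟨1, rfl⟩
  simp [semTrue] at hv

/-- Monotonicity of either operator suffices. In `Ty.V_avoid` it is known for the original body, so
strict positivity of the avoided body never has to be checked. -/
theorem approx_incl {F G : SemTy → SemTy} (hFG : ∀ S, (F S).Incl (G S))
    (h : (∀ S T : SemTy, S.Incl T → (F S).Incl (F T)) ∨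
      ∀ S T : SemTy, S.Incl T → (G S).Incl (G T)) (n : ℕ) :
    (approx F n).Incl (approx G n) := by
  induction n with
  | zero => exact fun _ h => h
  | succ n ih =>
    rcases h with h | h
    · exact fun v hv => hFG _ v (h _ _ ih v hv)
    · exact fun v hv => h _ _ ih v (hFG _ v hv)

/-- Both polarities are proved together because contravariant positions exchange them. -/
theorem Ty.V_avoid : ∀ (A : Ty) (i : ℕ) (δ : TyEnv) (ρ : Env),
    (A.V δ ρ).Incl ((A.avoid i true).V δ ρ) ∧ ((A.avoid i false).V δ ρ).Incl (A.V δ ρ)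
  | .var _, _, _, _ | .unit, _, _, _ | .tru, _, _, _ | .fls, _, _, _ | .int32, _, _, _
  | .top, _, _, _ | .bot, _, _, _ => ⟨fun _ h => h, fun _ h => h⟩
  | .pi A B, i, δ, ρ => by
    have hA := A.V_avoid i δ ρ
    have hB := fun va => B.V_avoid (i + 1) δ (va :: ρ)
    constructor <;> rintro v ⟨ρf, b, rfl, hv⟩ <;> refine ⟨ρf, b, rfl, fun va hva => ?_⟩
    · exact (hv va (hA.2 va hva)).mono (hB va).1
    · exact (hv va (hA.1 va hva)).mono (hB va).2
  | .all L U B, i, δ, ρ => by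
    have hL := L.V_avoid i δ ρ
    have hU := U.V_avoid i δ ρ
    have hB := fun S => B.V_avoid i (δ.cons S) ρ
    constructor <;> rintro v ⟨ρf, b, rfl, hv⟩ <;> refine ⟨ρf, b, rfl, fun S h₁ h₂ => ?_⟩
    · exact (hv S (fun w hw => h₁ w (hL.1 w hw)) fun w hw => hU.2 w (h₂ w hw)).mono (hB S).1
    · exact (hv S (fun w hw => h₁ w (hL.2 w hw)) fun w hw => hU.1 w (h₂ w hw)).mono (hB S).2
  | .sigma A B, i, δ, ρ => by
    have hA := A.V_avoid i δ ρ
    have hB := fun va => B.V_avoid (i + 1) δ (va :: ρ)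
    constructor <;> rintro v ⟨v₁, v₂, rfl, h₁, h₂⟩
    · exact ⟨v₁, v₂, rfl, hA.1 _ h₁, (hB _).1 _ h₂⟩
    · exact ⟨v₁, v₂, rfl, hA.2 _ h₁, (hB _).2 _ h₂⟩
  | .sum A B, i, δ, ρ => by
    have hA := A.V_avoid i δ ρ
    have hB := B.V_avoid i δ ρ
    constructor <;> rintro v (⟨w, rfl, h⟩ | ⟨w, rfl, h⟩)
    · exact .inl ⟨w, rfl, hA.1 _ h⟩
    · exact .inr ⟨w, rfl, hB.1 _ h⟩
    · exact .inl ⟨w, rfl, hA.2 _ h⟩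
    · exact .inr ⟨w, rfl, hB.2 _ h⟩
  | .union A B, i, δ, ρ => by
    have hA := A.V_avoid i δ ρ
    have hB := B.V_avoid i δ ρ
    exact ⟨fun v => Or.imp (hA.1 v) (hB.1 v), fun v => Or.imp (hA.2 v) (hB.2 v)⟩
  | .inter A B, i, δ, ρ => by
    have hA := A.V_avoid i δ ρ
    have hB := B.V_avoid i δ ρ
    exact ⟨fun v => And.imp (hA.1 v) (hB.1 v), fun v => And.imp (hA.2 v) (hB.2 v)⟩
  | .refine A p, i, δ, ρ => by
    have hA := A.V_avoid i δ ρ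
    constructor <;> rintro v ⟨h₁, h₂⟩ <;> by_cases hp : p.hasTm (i + 1) = true <;>
      simp only [Ty.avoid, Ty.V, hp, if_true] at h₂ ⊢
    · exact ⟨hA.1 v h₁, safe_tt _⟩
    · exact ⟨hA.1 v h₁, h₂⟩
    -- The predicate has become `false`, so the avoided refinement is empty.
    · exact (not_safe_ff _ h₂).elim
    · exact ⟨hA.2 v h₁, h₂⟩
  | .mu A, i, δ, ρ => by
    by_cases hA : A.spos 0 = true
    · simp only [Ty.avoid, hA, if_true]
      have hF : ∀ S T : SemTy, S.Incl T → (A.V (δ.cons S) ρ).Incl (A.V (δ.cons T) ρ) :=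
        fun S T => Ty.V_mono_of_spos hA δ ρ
      constructor <;> intro v hv n
      · exact approx_incl (fun S => (A.V_avoid i (δ.cons S) ρ).1) (.inl hF) n v (hv n)
      · exact approx_incl (fun S => (A.V_avoid i (δ.cons S) ρ).2) (.inr hF) n v (hv n)
    · simp only [Ty.avoid, hA, if_true]
      exact ⟨fun _ _ => trivial, fun _ h => h.elim⟩

theorem Ty.hasTm_avoid : ∀ (A : Ty) (i : ℕ) (pol : Bool), (A.avoid i pol).hasTm i = false
  | .var _, _, _ | .unit, _, _ | .tru, _, _ | .fls, _, _ | .int32, _, _ | .top, _, _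
  | .bot, _, _ => rfl
  | .pi A B, i, pol | .sigma A B, i, pol | .sum A B, i, pol | .union A B, i, pol
  | .inter A B, i, pol => by
    simp [Ty.avoid, Ty.hasTm, A.hasTm_avoid, B.hasTm_avoid]
  | .all L U B, i, pol => by
    simp [Ty.avoid, Ty.hasTm, L.hasTm_avoid, U.hasTm_avoid, B.hasTm_avoid]
  | .refine A p, i, pol => by
    by_cases hp : p.hasTm (i + 1) = true <;>
      simp [Ty.avoid, Ty.hasTm, A.hasTm_avoid, hp, Term.hasTm]
  | .mu A, i, pol => by
    by_cases hA : A.spos 0 = true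
    · simp [Ty.avoid, Ty.hasTm, hA, A.hasTm_avoid]
    · cases pol <;> simp [Ty.avoid, Ty.hasTm, hA]

/-- Once index `0` no longer occurs, lowering by `Nat.pred` merely drops the head of the
environment. -/
theorem Ty.V_incl_avoidTop (B : Ty) (δ : TyEnv) (ρ : Env) (v : Value) :
    (B.V δ (v :: ρ)).Incl (B.avoidTop.V δ ρ) := by
  have h : B.avoidTop.V δ ρ = (B.avoid 0 true).V δ (v :: ρ) :=
    Ty.V_ren _ (fun _ => rfl) fun x hx => by
      cases x with
      | zero => simp [B.hasTm_avoid] at hx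
      | succ x => simp
  rw [h]
  exact (B.V_avoid 0 δ (v :: ρ)).1

/-! ## Consistent assignments -/

theorem Wf.cons_tm {δ : TyEnv} {Γ : Ctx} {ρ : Env} (h : Wf δ Γ ρ) {A : Ty} {v : Value}
    (hv : A.V δ ρ v) : Wf δ (.tm A :: Γ) (v :: ρ) where
  tm x B hB := by
    cases x with
    | zero =>
      cases hB
      exact ⟨v, rfl, by rwa [Ty.V_shiftTm]⟩
    | succ x =>
      obtain ⟨C, hC, rfl⟩ := Option.map_eq_some_iff.1 hB
      obtain ⟨w, hw, hwC⟩ := h.tm x C hC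
      exact ⟨w, by simpa using hw, by rwa [Ty.V_shiftTm]⟩
  ty X L U hX := by
    obtain ⟨⟨L', U'⟩, hC, hLU⟩ := Option.map_eq_some_iff.1 hX
    cases hLU
    simpa only [Ty.V_shiftTm] using h.ty X L' U' hC
  facts := h.facts

theorem Wf.cons_ty {δ : TyEnv} {Γ : Ctx} {ρ : Env} (h : Wf δ Γ ρ) {L U : Ty} {S : SemTy}
    (hL : (L.V δ ρ).Incl S) (hU : S.Incl (U.V δ ρ)) : Wf (δ.cons S) (.ty L U :: Γ) ρ where
  tm x B hB := by
    obtain ⟨C, hC, rfl⟩ := Option.map_eq_some_iff.1 hB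
    simpa only [Ty.V_shiftTy] using h.tm x C hC
  ty X L' U' hX := by
    cases X with
    | zero =>
      cases hX
      simpa only [Ty.V_shiftTy] using ⟨hL, hU⟩
    | succ X =>
      obtain ⟨⟨L', U'⟩, hC, hLU⟩ := Option.map_eq_some_iff.1 hX
      cases hLU
      simp only [Ty.V_shiftTy]
      exact h.ty X L' U' hC
  facts := h.facts

theorem Wf.cons_fact {δ : TyEnv} {Γ : Ctx} {ρ : Env} (h : Wf δ Γ ρ) {d₁ d₂ : ℕ} {a₁ a₂ : Term}
    {v : Value} (h₁ : EvalsTo (ρ.drop (Ctx.depth Γ - d₁)) a₁ v)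
    (h₂ : EvalsTo (ρ.drop (Ctx.depth Γ - d₂)) a₂ v) : Wf δ (.fact d₁ a₁ d₂ a₂ :: Γ) ρ where
  tm := h.tm
  ty := h.ty
  facts := ⟨⟨v, h₁, h₂⟩, h.facts⟩

/-! ## Soundness of subtyping and typing -/

theorem Subtyping.incl {Γ : Ctx} {A B : Ty} (h : Subtyping Γ A B) :
    ∀ {δ : TyEnv} {ρ : Env}, Wf δ Γ ρ → (A.V δ ρ).Incl (B.V δ ρ) := by
  induction h with
  | refl => exact fun _ _ h => h
  | trans _ _ ih₁ ih₂ => exact fun hw v hv => ih₂ hw v (ih₁ hw v hv)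
  | top => exact fun _ _ _ => trivial
  | bot => exact fun _ _ h => h.elim
  | pi _ _ ih₁ ih₂ =>
    rintro δ ρ hw v ⟨ρf, b, rfl, hv⟩
    -- The codomains are compared under `x : A₁`. The argument comes from `B₁`, hence lies in `A₁`
    -- by contravariance.
    exact ⟨ρf, b, rfl, fun va hva =>
      (hv va (ih₁ hw va hva)).mono (ih₂ (hw.cons_tm (ih₁ hw va hva)))⟩
  | sigma _ _ ih₁ ih₂ =>
    rintro δ ρ hw v ⟨v₁, v₂, rfl, h₁, h₂⟩
    exact ⟨v₁, v₂, rfl, ih₁ hw _ h₁, ih₂ (hw.cons_tm h₁) _ h₂⟩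
  | orL => exact fun _ _ => Or.inl
  | orR => exact fun _ _ => Or.inr
  | or _ _ ih₁ ih₂ => exact fun hw v hv => hv.elim (ih₁ hw v) (ih₂ hw v)
  | andL => exact fun _ _ h => h.1
  | andR => exact fun _ _ h => h.2
  | and _ _ ih₁ ih₂ => exact fun hw v hv => ⟨ih₁ hw v hv, ih₂ hw v hv⟩
  | refineBase => exact fun _ _ h => h.1
  | refine _ himp ih =>
    rintro δ ρ hw v ⟨hv, hp⟩
    exact ⟨ih hw v hv, himp δ (v :: ρ) (hw.cons_tm hv) hp⟩
  | tvarUpper hX => exact fun hw => (hw.ty _ _ _ hX).2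
  | tvarLower hX => exact fun hw => (hw.ty _ _ _ hX).1
  | muUnfold _ hA => exact fun _ v => (Ty.V_mu_instTy hA _ _ v).2
  | muFold _ hA => exact fun _ v => (Ty.V_mu_instTy hA _ _ v).1
  | all _ _ _ ih₁ ih₂ ih₃ =>
    rintro δ ρ hw v ⟨ρf, b, rfl, hv⟩
    exact ⟨ρf, b, rfl, fun S hL hU =>
      (hv S (fun w h => hL w (ih₁ hw w h)) fun w h => ih₂ hw w (hU w h)).mono
        (ih₃ (hw.cons_ty hL hU))⟩

/-- Two constants that `==` and `!=` can compare. -/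
inductive Const.SameKind : Const → Const → Prop where
  | unit : SameKind .unit .unit
  | bool (a b : Bool) : SameKind (.bool a) (.bool b)
  | int (a b : ℤ) : SameKind (.int a) (.int b)

theorem Ty.firstorder.sameKind : ∀ {A : Ty}, A.firstorder → ∀ {δ : TyEnv} {ρ : Env}
    {v w : Value}, A.V δ ρ v → A.V δ ρ w → ∃ c d, v = .const c ∧ w = .const d ∧ c.SameKind d
  | .unit, _, _, _, _, _, rfl, rfl => ⟨_, _, rfl, rfl, .unit⟩
  | .tru, _, _, _, _, _, rfl, rfl => ⟨_, _, rfl, rfl, .bool _ _⟩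
  | .fls, _, _, _, _, _, rfl, rfl => ⟨_, _, rfl, rfl, .bool _ _⟩
  | .int32, _, _, _, _, _, ⟨_, rfl⟩, ⟨_, rfl⟩ => ⟨_, _, rfl, rfl, .int _ _⟩
  | .refine A _, hA, _, _, _, _, hv, hw => Ty.firstorder.sameKind (A := A) hA hv.1 hw.1

theorem Ty.V_bool {δ : TyEnv} {ρ : Env} {v : Value} :
    Ty.bool.V δ ρ v ↔ ∃ b, v = .const (.bool b) := by
  simp [Ty.bool, Ty.V, semTrue, or_comm]

theorem Op.delta_result {op : Op} {A : Ty} (h : op.compat A) {δ : TyEnv} {ρ : Env}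
    {v w : Value} (hv : A.V δ ρ v) (hw : A.V δ ρ w) :
    ∃ u, op.delta v w = some u ∧ op.result.V δ ρ u := by
  have hkind : (A.firstorder ∨ A = .bool) →
      ∃ c d, v = .const c ∧ w = .const d ∧ c.SameKind d := by
    rintro (h | rfl)
    · exact h.sameKind hv hw
    · obtain ⟨a, rfl⟩ := Ty.V_bool.1 hv
      obtain ⟨b, rfl⟩ := Ty.V_bool.1 hw
      exact ⟨_, _, rfl, rfl, .bool a b⟩
  cases op with
  | eq | ne =>
    obtain ⟨_, _, rfl, rfl, hcd⟩ := hkind h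
    cases hcd <;> exact ⟨_, rfl, Ty.V_bool.2 ⟨_, rfl⟩⟩
  | and | or =>
    cases h
    obtain ⟨a, rfl⟩ := Ty.V_bool.1 hv
    obtain ⟨b, rfl⟩ := Ty.V_bool.1 hw
    exact ⟨_, rfl, Ty.V_bool.2 ⟨_, rfl⟩⟩
  | lt | le | ge | gt =>
    cases h
    obtain ⟨a, rfl⟩ := hv
    obtain ⟨b, rfl⟩ := hw
    exact ⟨_, rfl, Ty.V_bool.2 ⟨_, rfl⟩⟩
  | plus | minus | times | quot | rem =>
    cases h
    obtain ⟨a, rfl⟩ := hv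
    obtain ⟨b, rfl⟩ := hw
    exact ⟨_, rfl, _, rfl⟩

theorem Const.SameKind.eq_self {c d : Const} (h : c.SameKind d) :
    Op.eq.evalConst c c = some (.bool true) := by
  cases h <;> simp [Op.evalConst]

/-- A variable lookup always terminates, so partial correctness here yields an actual value. -/
theorem Safe.var {S : SemTy} {ρ : Env} {y : ℕ} (h : Safe S ρ (.var y)) :
    ∃ v, ρ[y]? = some v ∧ S v := h _ ⟨1, rfl⟩

/-- `S` is the loop invariant. Running out of rounds is a timeout, which safety allows. -/
theorem loopIter_safeIn {S T : SemTy} {step : Value → Res}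
    (h : ∀ v, S v → (step v).SafeIn fun u =>
      (∃ w, u = .inl w ∧ S w) ∨ (∃ w, u = .inr w ∧ T w)) (k : ℕ) :
    ∀ v, S v → (loopIter step k v).SafeIn T := by
  induction k with
  | zero => rintro v _ x ⟨⟩
  | succ k ih =>
    intro v hv
    refine Res.SafeIn.andThen (h v hv) ?_
    rintro u - (⟨w, rfl, hw⟩ | ⟨w, rfl, hw⟩)
    · exact ih w hw
    · exact .value hw

/-- Re-evaluating the shifted `a` gives a value alike to `v`. First-order values are constants, for
which alike means equal, so `==` returns `true`. -/
theorem Safe.self_eq {A : Ty} (hA : A.firstorder) {δ : TyEnv} {ρ : Env} {a : Term} {v : Value}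
    (ha : EvalsTo ρ a v) (hv : A.V δ ρ v) :
    Safe semTrue (v :: ρ) (.binop .eq (.var 0) a.shiftTm) := by
  -- Pairing `v` with itself is a way to learn that it is a constant.
  obtain ⟨c, _, rfl, -, hc⟩ := hA.sameKind hv hv
  refine safe_of_succ fun n => ?_
  have hvar : Safe (fun w => w = .const c) (.const c :: ρ) (.var 0) :=
    safe_of_succ fun _ => .value rfl
  have hshift : Safe (fun w => w = .const c) (.const c :: ρ) a.shiftTm := by
    intro y hy
    obtain ⟨x, hx, hxy⟩ := hy.alike' (a.alike_ren (r := fun x y => y = x + 1) fun _ _ => rfl)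
      (Env.Alike.of_eq (ρ := ρ) fun x y h => by simp [h])
    cases ha.unique hx
    rcases hxy with @⟨_, _, h⟩
    cases h
    exact ⟨_, rfl, rfl⟩
  refine Res.SafeIn.andThen (safe_iff_safeIn.1 hvar n) ?_
  rintro _ - rfl
  refine Res.SafeIn.andThen (safe_iff_safeIn.1 hshift n) ?_
  rintro _ - rfl
  rw [Op.delta, hc.eq_self]
  exact .value rfl

theorem Typing.sound {Γ : Ctx} {a : Term} {A : Ty} (h : Typing Γ a A) :
    ∀ {δ : TyEnv} {ρ : Env}, Wf δ Γ ρ → Safe (A.V δ ρ) ρ a := by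
  induction h with
  | unit | tru | fls => exact fun _ => safe_of_succ fun _ => .value rfl
  | int _ z => exact fun _ => safe_of_succ fun _ => .value ⟨z, rfl⟩
  | var hx =>
    intro δ ρ hw
    obtain ⟨v, hv, hvA⟩ := hw.tm _ _ hx
    refine safe_of_succ fun n => ?_
    simp only [eval, hv]
    exact .value hvA
  | abs _ ih =>
    exact fun hw => safe_of_succ fun _ => .value ⟨_, _, rfl, fun va hva => ih (hw.cons_tm hva)⟩
  | app _ _ ihf ihy =>
    intro δ ρ hw
    obtain ⟨va, hy, hva⟩ := (ihy hw).var
    rw [Ty.V_instTm _ δ hy]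
    refine safe_of_succ fun n => ?_
    refine Res.SafeIn.andThen (safe_iff_safeIn.1 (ihf hw) n) ?_
    rintro _ - ⟨ρf, b, rfl, hb⟩
    -- The singleton type records that the argument is exactly the value `va` at which `B` was
    -- instantiated.
    refine Res.SafeIn.andThen (S := fun w => w = va)
      (safe_iff_safeIn.1 (safe_of_succ fun n => ?_) n) ?_
    · simp only [eval, hy]
      exact .value rfl
    · rintro _ - rfl
      exact safe_iff_safeIn.1 (hb _ hva) n
  | tabs _ ih =>
    exact fun hw => safe_of_succ fun _ =>
      .value ⟨_, _, rfl, fun S hL hU => ih (hw.cons_ty hL hU)⟩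
  | tapp _ hL hU ihf =>
    intro δ ρ hw
    rw [Ty.V_instTy]
    refine safe_of_succ fun n => ?_
    refine Res.SafeIn.andThen (safe_iff_safeIn.1 (ihf hw) n) ?_
    rintro _ - ⟨ρf, b, rfl, hb⟩
    -- The semantic type chosen for the bound variable is the interpretation of the type argument.
    exact safe_iff_safeIn.1 (hb _ (hL.incl hw) (hU.incl hw)) n
  | @letin Γ A B a b _ _ iha ihb =>
    intro δ ρ hw
    refine safe_of_succ fun n => ?_
    refine Res.SafeIn.andThen (safe_iff_safeIn.1 (iha hw) n) fun v hev hv => ?_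
    refine safe_iff_safeIn.1 (Safe.mono (ihb ?_) (Ty.V_incl_avoidTop B δ ρ v)) n
    -- The side `x` sees all of `v :: ρ` (drop `0`), while `a` sees only `ρ` (drop `1`).
    refine (hw.cons_tm hv).cons_fact (v := v) ?_ ?_
    · simpa [Ctx.depth] using
          show EvalsTo (v :: ρ) (.var 0) v from ⟨1, rfl⟩
    · simpa [Ctx.depth] using
          show EvalsTo ρ a v from ⟨n, hev⟩
  | pair _ _ ihy ih₂ =>
    intro δ ρ hw
    obtain ⟨va, hy, hva⟩ := (ihy hw).var
    have h₂ := ih₂ hw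
    rw [Ty.V_instTm _ δ hy] at h₂
    refine safe_of_succ fun n => ?_
    refine Res.SafeIn.andThen (S := fun w => w = va)
      (safe_iff_safeIn.1 (safe_of_succ fun n => ?_) n) ?_
    · simp only [eval, hy]
      exact .value rfl
    · rintro _ - rfl
      exact Res.SafeIn.andThen (safe_iff_safeIn.1 h₂ n) fun w _ hw =>
        .value ⟨_, w, rfl, hva, hw⟩
  | binop _ _ hop iha ihb =>
    intro δ ρ hw
    refine safe_of_succ fun n => ?_
    refine Res.SafeIn.andThen (safe_iff_safeIn.1 (iha hw) n) fun v _ hv => ?_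
    refine Res.SafeIn.andThen (safe_iff_safeIn.1 (ihb hw) n) fun w _ hw => ?_
    obtain ⟨u, hu, huR⟩ := Op.delta_result hop hv hw
    rw [hu]
    exact .value huR
  | @ite Γ a b₁ b₂ B₁ B₂ _ _ _ iha ih₁ ih₂ =>
    intro δ ρ hw
    refine safe_of_succ fun n => ?_
    refine Res.SafeIn.andThen (safe_iff_safeIn.1 (iha hw) n) fun v hev hv => ?_
    have ha : ∀ t, EvalsTo ρ t v → Wf δ (.fact (Ctx.depth Γ) a (Ctx.depth Γ) t :: Γ) ρ :=
      fun t ht => hw.cons_fact (v := v)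
        (by simpa using show EvalsTo ρ a v from ⟨n, hev⟩) (by simpa using ht)
    -- The case `false` comes first, hence the else branch.
    obtain ⟨_ | _, rfl⟩ := Ty.V_bool.1 hv
    · exact safe_iff_safeIn.1 ((ih₂ (ha _ ⟨1, rfl⟩)).mono fun _ => Or.inr) n
    · exact safe_iff_safeIn.1 ((ih₁ (ha _ ⟨1, rfl⟩)).mono fun _ => Or.inl) n
  | inl _ _ ih =>
    exact fun hw => safe_of_succ fun n => Res.SafeIn.andThen (safe_iff_safeIn.1 (ih hw) n)
      fun v _ hv => .value (.inl ⟨v, rfl, hv⟩)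
  | inr _ _ ih =>
    exact fun hw => safe_of_succ fun n => Res.SafeIn.andThen (safe_iff_safeIn.1 (ih hw) n)
      fun v _ hv => .value (.inr ⟨v, rfl, hv⟩)
  | loop _ _ iha ihb =>
    intro δ ρ hw
    refine safe_of_succ fun n => ?_
    refine Res.SafeIn.andThen (safe_iff_safeIn.1 (iha hw) n) fun v _ hv => ?_
    refine loopIter_safeIn (fun w hwA => ?_) n v hv
    -- The body's type is shifted, so its meaning is independent of the current state `w` and the
    -- invariant is the same in every round.
    have hb := ihb (hw.cons_tm hwA)
    rw [Ty.V_shiftTm] at hb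
    exact safe_iff_safeIn.1 hb n
  | self _ hA ih =>
    intro δ ρ hw x hx
    obtain ⟨v, rfl, hv⟩ := ih hw x hx
    exact ⟨v, rfl, hv, Safe.self_eq hA hx hv⟩
  | sub _ hAB ih => exact fun hw => (ih hw).mono (hAB.incl hw)
  | @matchPair Γ a b A B C _ _ iha ihb =>
    intro δ ρ hw
    refine safe_of_succ fun n => ?_
    refine Res.SafeIn.andThen (safe_iff_safeIn.1 (iha hw) n) ?_
    rintro _ - ⟨v₁, v₂, rfl, h₁, h₂⟩
    exact safe_iff_safeIn.1 (((ihb ((hw.cons_tm h₁).cons_tm h₂)).mono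
      (Ty.V_incl_avoidTop C δ (v₁ :: ρ) v₂)).mono (Ty.V_incl_avoidTop _ δ ρ v₁)) n
  | @matchSum Γ a b₁ b₂ A₁ A₂ B₁ B₂ _ _ _ iha ih₁ ih₂ =>
    intro δ ρ hw
    refine safe_of_succ fun n => ?_
    refine Res.SafeIn.andThen (safe_iff_safeIn.1 (iha hw) n) ?_
    rintro u hev (⟨v, rfl, hv⟩ | ⟨v, rfl, hv⟩)
    · refine safe_iff_safeIn.1 (((ih₁ ?_).mono (Ty.V_incl_avoidTop B₁ δ ρ v)).mono
        fun _ => Or.inl) n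
      refine (hw.cons_tm hv).cons_fact (v := .inl v) ?_ ?_
      · simpa [Ctx.depth] using
          show EvalsTo ρ a (.inl v) from ⟨n, hev⟩
      · simpa [Ctx.depth] using
          -- Fuel `2`: one unit for the injection and one for the variable.
          show EvalsTo (v :: ρ) (.inl A₂.shiftTm (.var 0)) (.inl v) from ⟨2, rfl⟩
    · refine safe_iff_safeIn.1 (((ih₂ ?_).mono (Ty.V_incl_avoidTop B₂ δ ρ v)).mono
        fun _ => Or.inr) n
      refine (hw.cons_tm hv).cons_fact (v := .inr v) ?_ ?_
      · simpa [Ctx.depth] using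
          show EvalsTo ρ a (.inr v) from ⟨n, hev⟩
      · simpa [Ctx.depth] using
          show EvalsTo (v :: ρ) (.inr A₁.shiftTm (.var 0)) (.inr v) from ⟨2, rfl⟩

end RefCore

theorem theorem1 (Γ : RefCore.Ctx) (a : RefCore.Term) (A : RefCore.Ty)
    (h : RefCore.Typing Γ a A) : RefCore.SemTyping Γ a A :=
  fun _ _ hw => h.sound hw
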